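/- There is a polynomial $P\in\mathbb N[X]$ such that the following holds for every $d\in\mathbb N$ and every IP-GCD system $\Phi(\vec x)$ in $d$ integer variables, i.e. every system $A\vec x\le \vec b\ \wedge\ \bigwedge_{i=1}^k \gcd(f_i(\vec x),g_i(\vec x))\sim_i c_i$ with $A,\vec b$ integral, $f_i,g_i$ linear polynomials (possibly with a constant term) with integer coefficients, ${\sim_i}\in\{\le,=,\ne,\ge\}$ and $c_i$ positive integers (with $\gcd(0,n)=|n|$). There is a set $C$ of GCD-to-DIV triples $(\Psi,\vec u,E)$ such that $$\{\vec x\in\mathbb Z^d : \vec x \text{ is a solution of } \Phi\}=\{\vec u+E\vec\lambda : (\Psi,\vec u,E)\in C,\ \vec\lambda\in\mathbb N^m \text{ a solution of } \Psi\},$$ where $m$ is the number of variables of $\Psi$ (and of columns of $E$), and every $(\Psi,\vec u,E)\in C$ has bit length at most $P(|\Phi|)$, where $|\Phi|$ is the bit length of $\Phi$, and is such that $\Psi$ is $3$-increasing. Here the following notions are used. *Systems of divisibility constraints.* Such a system is a finite conjunction (a list) $\Psi=\bigwedge_i f_i\mid g_i$ with $f_i,g_i$ integer linear polynomials; $\vec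 a$ is a solution if $f_i(\vec a)\ne0$ and $f_i(\vec a)$ divides $g_i(\vec a)$ for all $i$. *$r$-increasing systems.* A linear polynomial is primitive if it is non-zero and the gcd of its coefficients and constant is $1$. For a primitive $f$, the divisibility module $M_f(\Psi)$ is the smallest $\mathbb Z$-module of linear polynomials that contains $f$ and contains $b\cdot h$ whenever $g\mid h$ is a constraint of $\Psi$, $b\in\mathbb Z$ and $b\cdot g$ is in the module. For a total order $\prec$ on the variables, $\Psi$ is in increasing form if, for every primitive non-constant $f$ with $\prec$-largest occurring variable $x$, the elements of $M_f(\Psi)$ all of whose variables are $\preceq x$ are exactly the elements of $\mathbb Z f$. The system $\Psi$ is $r$-increasing if its variables can be partitioned into (possibly empty) classes $X_1,\dots,X_r$ such that $\Psi$ is in increasing form for every total order that places all variables of $X_i$ before all variables of $X_j$ whenever $i<j$. *GCD-to-DIV triples.* A triple $(\Psi,\vec u,E)$, with $\Psi$ a system of divisibility constraints in $m$ variables, $\vec u\in\mathbb Z^d$ and $E\in\mathbb Z^{d\times m}$ with columns indexed by the variables of $\Psi$, is a GCD-to-DIV triple if the variables split into three disjoint families $\vec z,\vec y,\vec w$ such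 that: 1. each divisibility has the form $h(\vec z)\mid f(\vec y)$, or $f(\vec y)\mid g(\vec w)$ with $g$ non-constant; all coefficients and constants are non-negative, and each left-hand side has a positive constant; 2. each variable $z$ in $\vec z$ appears in a single polynomial, which is of the form $z+c$ with $c>0$ an integer and occurs in precisely two divisibilities, as left-hand side; 3. each variable $w$ in $\vec w$ appears in exactly two polynomials, $w$ and $w+c$ with $c>0$ an integer, each occurring exactly once, as a right-hand side; 4. the columns of $E$ of variables in $\vec z$ or $\vec w$ are zero. *Bit lengths.* The bit length of an integer $a$ is $1+\lceil\log_2(|a|+1)\rceil$. The bit length of a vector or list of $n$ objects is $n$ plus the sum of the bit lengths of the objects, and a matrix is read as the vector of its columns. A linear polynomial $\vec a^{\intercal}\vec x+c$ has the sum of the bit lengths of $\vec a$ and $c$, plus $1$. A divisibility has the sum of the bit lengths of its two sides, and a GCD constraint $\gcd(f,g)\sim c$ has the sum of those of $f$, $g$ and $c$, plus $1$. A system or triple has the sum of the bit lengths of its components. -/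

import Mathlib

/-! Integer programming with GCD constraints, systems of divisibility constraints,
increasing forms, and GCD-to-DIV triples. -/

namespace IPGCD

/-- Linear polynomials `a₁ x₁ + ⋯ + aₙ xₙ + c` with integer coefficients: the pair `(a, c)`. -/
abbrev LinPoly (n : ℕ) : Type := (Fin n → ℤ) × ℤ

namespace LinPoly

variable {n : ℕ}

/-- The coefficient of the variable `i`. -/
def coeff (f : LinPoly n) (i : Fin n) : ℤ := f.1 i

/-- The constant of `f`. -/
def const (f : LinPoly n) : ℤ := f.2

/-- The value of `f` at the integer point `x`. -/
def eval (f : LinPoly n) (x : Fin n → ℤ) : ℤ := ∑ i, f.coeff i * x i + f.const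

/-- The polynomial `xᵢ + c`. -/
def varAdd (i : Fin n) (c : ℤ) : LinPoly n := (Pi.single i 1, c)

/-- The greatest common divisor of all coefficients and of the constant. -/
def content (f : LinPoly n) : ℕ := Int.gcd (Finset.univ.gcd f.coeff) f.const

/-- Primitive polynomials: non-zero, and the gcd of coefficients and constant is `1`. -/
def IsPrimitive (f : LinPoly n) : Prop := f ≠ 0 ∧ f.content = 1

/-- `x` is the leading variable of `f` for the strict order `lt` on the variables:
the `lt`-maximal variable with a non-zero coefficient in `f`. -/
def IsLeadingVar (lt : Fin n → Fin n → Prop) (f : LinPoly n) (x : Fin n) : Prop :=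
  f.coeff x ≠ 0 ∧ ∀ y, f.coeff y ≠ 0 → y = x ∨ lt y x

/-- Every variable that occurs in `f` belongs to `S`. -/
def VarsIn (f : LinPoly n) (S : Set (Fin n)) : Prop := ∀ i, f.coeff i ≠ 0 → i ∈ S

/-- `f` is a constant polynomial. -/
def IsConstant (f : LinPoly n) : Prop := ∀ i, f.coeff i = 0

/-- All coefficients and the constant of `f` are non-negative. -/
def IsNonneg (f : LinPoly n) : Prop := (∀ i, 0 ≤ f.coeff i) ∧ 0 ≤ f.const

end LinPoly

/-! ### IP-GCD systems -/

/-- The comparison relations allowed in a GCD constraint. -/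
inductive Rel
  | le
  | eq
  | ne
  | ge

/-- The meaning of a comparison relation. -/
def Rel.Holds : Rel → ℕ → ℕ → Prop
  | .le, a, b => a ≤ b
  | .eq, a, b => a = b
  | .ne, a, b => a ≠ b
  | .ge, a, b => a ≥ b

/-- A GCD constraint `gcd(f(x), g(x)) ∼ c` in `d` variables, with `c` a positive integer. -/
structure GCDConstraint (d : ℕ) where
  f : LinPoly d
  g : LinPoly d
  rel : Rel
  c : ℕ
  c_pos : 0 < c

/-- The integer point `x` satisfies the GCD constraint (here `gcd(0, n) = |n|`). -/
def GCDConstraint.Holds {d : ℕ} (γ : GCDConstraint d) (x : Fin d → ℤ) : Prop :=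
  γ.rel.Holds (Int.gcd (γ.f.eval x) (γ.g.eval x)) γ.c

/-- An IP-GCD system `A x ≤ b ∧ ⋀ᵢ gcd(fᵢ(x), gᵢ(x)) ∼ᵢ cᵢ` in `d` variables. -/
structure System (d : ℕ) where
  rows : ℕ
  A : Matrix (Fin rows) (Fin d) ℤ
  b : Fin rows → ℤ
  gcds : List (GCDConstraint d)

/-- `x` is an integer solution of the IP-GCD system. -/
def System.IsSolution {d : ℕ} (Φ : System d) (x : Fin d → ℤ) : Prop :=
  (∀ i, (Φ.A.mulVec x) i ≤ Φ.b i) ∧ ∀ γ ∈ Φ.gcds, γ.Holds x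

/-! ### Systems of divisibility constraints -/

/-- A divisibility constraint `lhs ∣ rhs` in `n` variables. -/
structure DivConstraint (n : ℕ) where
  lhs : LinPoly n
  rhs : LinPoly n

/-- A system (finite conjunction) of divisibility constraints in `n` variables. -/
abbrev DivSystem (n : ℕ) : Type := List (DivConstraint n)

namespace DivSystem

variable {n : ℕ}

/-- `x` is a solution. A constraint `f ∣ g` holds at `x` when there is a unique integer `q`
with `g(x) = q f(x)`; in particular `f(x) ≠ 0`. -/
def IsSolution (Ψ : DivSystem n) (x : Fin n → ℤ) : Prop :=
  ∀ δ ∈ Ψ, ∃! q : ℤ, δ.rhs.eval x = q * δ.lhs.eval x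

/-- The polynomial `f` is a side of some constraint of `Ψ`. -/
def IsTerm (Ψ : DivSystem n) (f : LinPoly n) : Prop := ∃ δ ∈ Ψ, f = δ.lhs ∨ f = δ.rhs

/-- The divisibility module of `f` with respect to `Ψ`: the smallest `ℤ`-module `M` with `f ∈ M`
and such that `b • h ∈ M` whenever `g ∣ h` is a constraint of `Ψ` and `b • g ∈ M`. -/
def divModule (Ψ : DivSystem n) (f : LinPoly n) : Submodule ℤ (LinPoly n) :=
  sInf {M | f ∈ M ∧ ∀ δ ∈ Ψ, ∀ b : ℤ, b • δ.lhs ∈ M → b • δ.rhs ∈ M}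

/-- `Ψ` is in increasing form for the strict order `lt` on the variables: for every primitive
`f` with leading variable `x`, the members of the divisibility module of `f` all of whose
variables are at most `x` are exactly the integer multiples of `f`. -/
def IsIncreasing (Ψ : DivSystem n) (lt : Fin n → Fin n → Prop) : Prop :=
  ∀ (f : LinPoly n) (x : Fin n), f.IsPrimitive → f.IsLeadingVar lt x →
    {g : LinPoly n | g ∈ Ψ.divModule f ∧ g.VarsIn {y | y = x ∨ lt y x}} =
      {g : LinPoly n | ∃ b : ℤ, g = b • f}

/-- `Ψ` is `r`-increasing: the variables can be partitioned into `X₁, …, X_r` (`part` sends a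
variable to the index of its class; classes may be empty) so that `Ψ` is in increasing form for
every total order that puts the variables of `Xᵢ` before those of `Xⱼ` whenever `i < j`. -/
def IsRIncreasing (r : ℕ) (Ψ : DivSystem n) : Prop :=
  ∃ part : Fin n → Fin r, ∀ lt : Fin n → Fin n → Prop, IsStrictTotalOrder (Fin n) lt →
    (∀ x y, part x < part y → lt x y) → Ψ.IsIncreasing lt

end DivSystem

/-! ### GCD-to-DIV triples -/

/-- A triple `(Ψ, u, E)`: a system `Ψ` of divisibility constraints in `m` variables, a vector
`u ∈ ℤ^d` and a matrix `E ∈ ℤ^(d × m)` whose columns correspond to the variables of `Ψ`. -/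
structure Triple (d : ℕ) where
  m : ℕ
  Ψ : DivSystem m
  u : Fin d → ℤ
  E : Matrix (Fin d) (Fin m) ℤ

/-- The three families of variables of a GCD-to-DIV triple. -/
inductive Family
  | z
  | y
  | w

/-- GCD-to-DIV triples. The map `κ` splits the variables into three disjoint families. -/
def Triple.IsGcdToDiv {d : ℕ} (T : Triple d) : Prop :=
  ∃ κ : Fin T.m → Family,
    -- shape of the divisibilities
    (∀ δ ∈ T.Ψ,
      ((δ.lhs.VarsIn {i | κ i = .z} ∧ δ.rhs.VarsIn {i | κ i = .y}) ∨
        (δ.lhs.VarsIn {i | κ i = .y} ∧ δ.rhs.VarsIn {i | κ i = .w} ∧ ¬ δ.rhs.IsConstant)) ∧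
      δ.lhs.IsNonneg ∧ δ.rhs.IsNonneg ∧ 0 < δ.lhs.const) ∧
    -- a `z`-variable occurs in a single polynomial `z + c`, the left-hand side of precisely two
    -- divisibilities
    (∀ i, κ i = .z → ∃ c : ℤ, 0 < c ∧
      (∀ f, T.Ψ.IsTerm f → f.coeff i ≠ 0 → f = LinPoly.varAdd i c) ∧
      (T.Ψ.map DivConstraint.lhs).count (LinPoly.varAdd i c) = 2) ∧
    -- a `w`-variable occurs in exactly two polynomials `w` and `w + c`, each occurring once, as
    -- a right-hand side
    (∀ i, κ i = .w → ∃ c : ℤ, 0 < c ∧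
      (∀ f, T.Ψ.IsTerm f → f.coeff i ≠ 0 →
        f = LinPoly.varAdd i 0 ∨ f = LinPoly.varAdd i c) ∧
      (T.Ψ.map DivConstraint.rhs).count (LinPoly.varAdd i 0) = 1 ∧
      (T.Ψ.map DivConstraint.rhs).count (LinPoly.varAdd i c) = 1) ∧
    -- the columns of `E` for the `z`- and `w`-variables are zero
    (∀ i, κ i = .z ∨ κ i = .w → ∀ j, T.E j i = 0)

/-! ### Bit lengths -/

/-- The bit length `1 + ⌈log₂ (|a| + 1)⌉` of an integer. -/
def intSize (a : ℤ) : ℕ := 1 + Nat.clog 2 (a.natAbs + 1)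

/-- The bit length of a vector of `n` objects of bit lengths `s i`. -/
def vecSize {n : ℕ} (s : Fin n → ℕ) : ℕ := n + ∑ i, s i

/-- The bit length of a list of objects whose bit lengths are given by `s`. -/
def listSize {α : Type} (s : α → ℕ) (l : List α) : ℕ := l.length + (l.map s).sum

/-- The bit length of a matrix, as the vector of its columns. -/
def matrixSize {p q : ℕ} (M : Matrix (Fin p) (Fin q) ℤ) : ℕ :=
  vecSize fun j => vecSize fun i => intSize (M i j)

/-- The bit length of a linear polynomial. -/
def LinPoly.size {n : ℕ} (f : LinPoly n) : ℕ :=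
  vecSize (fun i => intSize (f.coeff i)) + intSize f.const + 1

/-- The bit length of a GCD constraint. -/
def GCDConstraint.size {d : ℕ} (γ : GCDConstraint d) : ℕ :=
  γ.f.size + γ.g.size + intSize γ.c + 1

/-- The bit length of an IP-GCD system. -/
def System.size {d : ℕ} (Φ : System d) : ℕ :=
  matrixSize Φ.A + vecSize (fun i => intSize (Φ.b i)) + listSize GCDConstraint.size Φ.gcds

/-- The bit length of a system of divisibility constraints. -/
def DivSystem.size {n : ℕ} (Ψ : DivSystem n) : ℕ :=
  listSize (fun δ : DivConstraint n => δ.lhs.size + δ.rhs.size) Ψ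

/-- The bit length of a triple. -/
def Triple.size {d : ℕ} (T : Triple d) : ℕ :=
  T.Ψ.size + vecSize (fun i => intSize (T.u i)) + matrixSize T.E

end IPGCD

/-!
Fix a solution `x` of the system. It suffices to find one triple of polynomial bit length whose set
contains `x` and consists of solutions; `C` collects all such triples.

* Add to `A x ≤ b` the inequalities that fix the signs of the polynomials under the gcd at `x`.
  Decomposing integer points of polyhedra (`exists_polyhedron_decomposition`, where Siegel's lemma
  bounds the vectors of a conic decomposition in a kernel) yields `x = u + E λ` where
  `λ ≥ 0`, the point `u` satisfies all inequalities, the columns of `E` are recession directions,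
  and all entries of `u` and `E` have polynomial bit length. As polynomials in `λ`, the polynomials
  under the gcd have, up to sign, non-negative coefficients and constants.
* By the pigeonhole principle (`exists_gap`) there is a bound `B` of polynomial bit length such that
  no coordinate of `λ` and no gcd at `x` lies between `B` and a much larger `L`. The small
  coordinates of `λ` are fixed to their values and absorbed in `u`
  (`exists_gap_decomposition`).
* A gcd that is at most `B` at `x` is required to keep its value `v`: the class of `λ` modulo the
  product `N` of these values is fixed, so that `v` divides both polynomials `F`, `G`, and
  `F ∣ w ∧ G ∣ w + v` expresses that the gcd divides `v`. A gcd that exceeds `L` at `x` satisfies a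
  constraint `≥ c` or `≠ c`, and `z + (c + 1) ∣ F ∧ z + (c + 1) ∣ G` preserves it. If one
  of the two polynomials vanishes, a small gcd is constant and needs no constraint.
* The gap makes the system 3-increasing with the classes `z`, `y`, `w`
  (`GcdFamily.independent_of_gap`, `GcdFamily.isRIncreasing`). A divisibility module could only
  violate the increasing form through a constant in the span of `F` and `G` for some `z`, through
  proportional `F` and `G` for some `w`, or through a span of the former kind that contains both
  polynomials of a `w`. In each case Cramer's rule bounds a gcd or a variable that the gap makes
  large.
-/

namespace IPGCD

/-! ### Small non-negative vectors in the kernel of an integer matrix -/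

section Kernel

open Matrix in
/-- Siegel's lemma with an integer bound that does not depend on the number of rows. -/
theorem exists_ker_vec_natAbs_le {α β : Type} [Fintype α] [Fintype β]
    (A : Matrix α β ℤ) (K : ℕ) (hK1 : 1 ≤ K) (hK : ∀ i j, (A i j).natAbs ≤ K)
    (hcard : Fintype.card α < Fintype.card β) :
    ∃ t : β → ℤ, t ≠ 0 ∧ A *ᵥ t = 0 ∧
      ∀ j, (t j).natAbs ≤ (Fintype.card β * K) ^ Fintype.card β := by
  classical
  have hn1 : 1 ≤ Fintype.card β * K := Nat.mul_pos (by omega) hK1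
  rcases Nat.eq_zero_or_pos (Fintype.card α) with h0 | hpos
  · have : IsEmpty α := Fintype.card_eq_zero_iff.mp h0
    have hβ : Nonempty β := Fintype.card_pos_iff.mp (by omega)
    refine ⟨fun _ => 1, fun h => ?_, Subsingleton.elim _ _, fun j => ?_⟩
    · simpa using congrFun h hβ.some
    · simpa using Nat.one_le_pow _ _ hn1
  · let : SeminormedAddCommGroup (Matrix α β ℤ) := Matrix.seminormedAddCommGroup
    obtain ⟨t, ht0, htA, htn⟩ := Int.Matrix.exists_ne_zero_int_vec_norm_le A hcard hpos
    refine ⟨t, ht0, htA, fun j => ?_⟩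
    have hcast : (1 : ℝ) ≤ (Fintype.card β : ℝ) - Fintype.card α := by
      have : (Fintype.card α : ℝ) + 1 ≤ Fintype.card β := by exact_mod_cast hcard
      linarith
    have hnorm : ‖A‖ ≤ K := by
      rw [Matrix.norm_le_iff (by positivity)]
      intro i j
      rw [Int.norm_eq_abs, ← Int.cast_abs, Int.abs_eq_natAbs]
      exact_mod_cast hK i j
    have hmax : max 1 ‖A‖ ≤ (K : ℝ) := max_le (by exact_mod_cast hK1) hnorm
    have hexp : (Fintype.card α : ℝ) / ((Fintype.card β : ℝ) - Fintype.card α)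
        ≤ (Fintype.card β : ℕ) := by
      refine (div_le_self (by positivity) hcast).trans ?_
      exact_mod_cast hcard.le
    have h1 : ‖t j‖ ≤ ((Fintype.card β : ℝ) * K) ^ Fintype.card β := by
      refine (norm_le_pi_norm t j).trans (htn.trans ?_)
      rw [← Real.rpow_natCast]
      refine (Real.rpow_le_rpow (by positivity) (mul_le_mul_of_nonneg_left hmax (by positivity))
        (by positivity)).trans ?_
      exact Real.rpow_le_rpow_of_exponent_le (by exact_mod_cast hn1) hexp
    rw [Int.norm_eq_abs, ← Int.cast_abs, Int.abs_eq_natAbs] at h1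
    exact_mod_cast h1

variable {ι ρ : Type} [Fintype ι]

/-- A vector orthogonal to a family is orthogonal to its span. -/
theorem dotProduct_eq_zero_of_mem_span {s : Set (ι → ℚ)} {X w : ι → ℚ}
    (hs : ∀ v ∈ s, v ⬝ᵥ X = 0) (hw : w ∈ Submodule.span ℚ s) : w ⬝ᵥ X = 0 := by
  induction hw using Submodule.span_induction with
  | mem x hx => exact hs x hx
  | zero => simp
  | add x y _ _ hx hy => simp [add_dotProduct, hx, hy]
  | smul c x _ hx => simp [smul_dotProduct, hx]

/-- Rows of `M` cut out the same kernel as a subfamily of fewer than `card ι` rows, as soon as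
the kernel is non-trivial; so there is a small integer kernel vector, with support in `S`. -/
theorem exists_ker_vec_support_subset [Finite ρ] (M : ρ → ι → ℤ) (K : ℕ) (hK1 : 1 ≤ K)
    (hK : ∀ i j, (M i j).natAbs ≤ K) (X : ι → ℚ) (hX : X ≠ 0)
    (hM : ∀ r, ∑ j, (M r j : ℚ) * X j = 0) :
    ∃ C : ι → ℤ, C ≠ 0 ∧ (∀ r, ∑ j, M r j * C j = 0) ∧ (∀ j, X j = 0 → C j = 0) ∧
      ∀ j, (C j).natAbs ≤ (Fintype.card ι * K) ^ Fintype.card ι := by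
  classical
  have := Fintype.ofFinite ρ
  -- unit rows force the support of the kernel vectors into the support of `X`
  let W : ρ ⊕ {j // X j = 0} → ι → ℤ := Sum.elim M (fun j => Pi.single j.1 1)
  let v : ρ ⊕ {j // X j = 0} → ι → ℚ := fun r j => (W r j : ℚ)
  have hvX : ∀ r, v r ⬝ᵥ X = 0 := by
    rintro (r | ⟨j, hj⟩)
    · exact hM r
    · simp [v, W, dotProduct, Pi.single_apply, hj]
  obtain ⟨κ, a, ha, hsp, hli⟩ := exists_linearIndependent' ℚ v
  have : Fintype κ := Fintype.ofInjective a ha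
  have hcard : Fintype.card κ < Fintype.card ι := by
    have hle : Fintype.card κ ≤ Fintype.card ι := by simpa using hli.fintype_card_le_finrank
    refine lt_of_le_of_ne hle fun heq => hX ?_
    have htop := hli.span_eq_top_of_card_eq_finrank' (by simpa using heq)
    have hall : ∀ w : ι → ℚ, w ⬝ᵥ X = 0 := fun w =>
      dotProduct_eq_zero_of_mem_span (by rintro _ ⟨r, rfl⟩; exact hvX _)
        (htop ▸ Submodule.mem_top : w ∈ Submodule.span ℚ (Set.range (v ∘ a)))
    exact dotProduct_self_eq_zero.mp (hall X)
  obtain ⟨C, hC0, hCA, hCb⟩ := exists_ker_vec_natAbs_le (Matrix.of fun r => W (a r)) K hK1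
    (by
      intro r j
      change (W (a r) j).natAbs ≤ K
      rcases a r with r | r
      · exact hK r j
      · by_cases h : j = r.1 <;> simp [W, h, hK1]) hcard
  have hker : ∀ r, v r ⬝ᵥ (fun j => (C j : ℚ)) = 0 := fun r => by
    refine dotProduct_eq_zero_of_mem_span ?_
      (hsp ▸ Submodule.subset_span ⟨r, rfl⟩ : v r ∈ Submodule.span ℚ (Set.range (v ∘ a)))
    rintro _ ⟨s, rfl⟩
    have := congrFun hCA s
    simp only [Matrix.mulVec, dotProduct, Matrix.of_apply, Pi.zero_apply] at this
    simp only [dotProduct, v, Function.comp]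
    exact_mod_cast this
  refine ⟨C, hC0, fun r => ?_, fun j hj => ?_, hCb⟩
  · have := hker (.inl r)
    simp only [dotProduct, v, W, Sum.elim_inl] at this
    exact_mod_cast this
  · have := hker (.inr ⟨j, hj⟩)
    simpa [dotProduct, v, W, Pi.single_apply] using this

/-- If the kernel of `M` contains a non-zero non-negative vector `X`, it contains a small
non-negative integer vector with support inside that of `X`. If a small integer kernel vector inside
the support has entries of both signs, subtracting a multiple of it from `X` yields a non-negative
kernel vector of smaller support. -/
theorem exists_nonneg_ker_vec [Finite ρ] (M : ρ → ι → ℤ) (K : ℕ) (hK1 : 1 ≤ K)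
    (hK : ∀ i j, (M i j).natAbs ≤ K) (X : ι → ℚ) (hX0 : X ≠ 0) (hX : 0 ≤ X)
    (hM : ∀ r, ∑ j, (M r j : ℚ) * X j = 0) :
    ∃ C : ι → ℕ, C ≠ 0 ∧ (∀ r, ∑ j, M r j * (C j : ℤ) = 0) ∧ (∀ j, X j = 0 → C j = 0) ∧
      ∀ j, C j ≤ (Fintype.card ι * K) ^ Fintype.card ι := by
  classical
  induction hn : (Finset.univ.filter fun j => X j ≠ 0).card using Nat.strong_induction_on
    generalizing X with
  | _ n ih =>
  subst hn
  obtain ⟨C, hC0, hCM, hCX, hCb⟩ := exists_ker_vec_support_subset M K hK1 hK X hX0 hM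
  wlog hpos : ∃ j, 0 < C j generalizing C
  · push Not at hpos
    refine this (-C) (by simpa using hC0) (fun r => ?_) (fun j hj => by simp [hCX j hj])
      (fun j => by simpa using hCb j) ?_
    · simpa using hCM r
    · by_contra! h
      exact hC0 (funext fun j => le_antisymm (hpos j) (by simpa using h j))
  by_cases hnn : ∀ j, 0 ≤ C j
  · refine ⟨fun j => (C j).natAbs, fun h => hC0 (funext fun j => ?_), fun r => ?_, fun j hj => ?_,
      hCb⟩
    · simpa using congrFun h j
    · simpa [abs_of_nonneg (hnn _)] using hCM r
    · simp [hCX j hj]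
  -- otherwise subtract the largest multiple of `C` that keeps `X` non-negative
  push Not at hnn
  obtain ⟨j₁, hj₁⟩ := hnn
  have hne : (Finset.univ.filter fun j => 0 < C j).Nonempty := by
    obtain ⟨j, hj⟩ := hpos; exact ⟨j, by simpa using hj⟩
  obtain ⟨j₀, hj₀, hmin⟩ := Finset.exists_min_image _ (fun j => X j / C j) hne
  simp only [Finset.mem_filter, Finset.mem_univ, true_and] at hj₀ hmin
  have hc₀ : (0 : ℚ) < C j₀ := by exact_mod_cast hj₀
  set q := X j₀ / C j₀ with hq
  have hq0 : 0 ≤ q := div_nonneg (hX j₀) hc₀.le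
  let Y : ι → ℚ := fun j => X j - q * C j
  have hYX : ∀ j, X j = 0 → Y j = 0 := fun j hj => by simp [Y, hj, hCX j hj]
  have hlt : (Finset.univ.filter fun j => Y j ≠ 0).card <
      (Finset.univ.filter fun j => X j ≠ 0).card := by
    refine Finset.card_lt_card ⟨fun j hj => ?_, fun h => ?_⟩
    · simp only [Finset.mem_filter, Finset.mem_univ, true_and] at hj ⊢
      exact fun h => hj (hYX j h)
    · have hX₀ : X j₀ ≠ 0 := fun h => hj₀.ne' (hCX j₀ h)
      have := h (by simpa using hX₀ : j₀ ∈ _)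
      simp [Y, hq, div_mul_cancel₀ _ hc₀.ne'] at this
  have hXj₁ : 0 < X j₁ := lt_of_le_of_ne (hX j₁) fun h => hj₁.ne (hCX j₁ h.symm)
  have hcj₁ : (C j₁ : ℚ) < 0 := by exact_mod_cast hj₁
  obtain ⟨C', h1, h2, h3, h4⟩ := ih _ hlt Y
    (fun h => by
      have h5 : X j₁ - q * C j₁ = 0 := congrFun h j₁
      nlinarith)
    (fun j => by
      change 0 ≤ X j - q * C j
      rcases lt_or_ge 0 (C j) with h | h
      · have h' : (0 : ℚ) < C j := by exact_mod_cast h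
        have := (le_div_iff₀ h').mp (hmin j h)
        linarith
      · have h' : (C j : ℚ) ≤ 0 := by exact_mod_cast h
        have := hX j
        simp only [Pi.zero_apply] at this
        nlinarith)
    (fun r => by
      have : ∑ j, (M r j : ℚ) * C j = 0 := by exact_mod_cast hCM r
      simp only [Y, mul_sub, Finset.sum_sub_distrib, hM r, mul_left_comm _ q, ← Finset.mul_sum,
        this]
      ring) rfl
  exact ⟨C', h1, h2, fun j hj => h3 j (hYX j hj), h4⟩

/-- Every non-negative kernel vector is a non-negative combination of at most `card ι` small
non-negative integer kernel vectors. -/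
theorem exists_conic_decomposition [Finite ρ] (M : ρ → ι → ℤ) (K : ℕ) (hK1 : 1 ≤ K)
    (hK : ∀ i j, (M i j).natAbs ≤ K) (X : ι → ℚ) (hX : 0 ≤ X)
    (hM : ∀ r, ∑ j, (M r j : ℚ) * X j = 0) :
    ∃ t ≤ Fintype.card ι, ∃ (C : Fin t → ι → ℕ) (μ : Fin t → ℚ), 0 ≤ μ ∧
      (∀ j, X j = ∑ k, μ k * C k j) ∧ (∀ k r, ∑ j, M r j * (C k j : ℤ) = 0) ∧
      ∀ k j, C k j ≤ (Fintype.card ι * K) ^ Fintype.card ι := by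
  classical
  suffices ∃ t ≤ (Finset.univ.filter fun j => X j ≠ 0).card,
      ∃ (C : Fin t → ι → ℕ) (μ : Fin t → ℚ), 0 ≤ μ ∧
      (∀ j, X j = ∑ k, μ k * C k j) ∧ (∀ k r, ∑ j, M r j * (C k j : ℤ) = 0) ∧
      ∀ k j, C k j ≤ (Fintype.card ι * K) ^ Fintype.card ι by
    obtain ⟨t, ht, h⟩ := this
    exact ⟨t, ht.trans (Finset.card_le_univ _), h⟩
  induction hn : (Finset.univ.filter fun j => X j ≠ 0).card using Nat.strong_induction_on
    generalizing X with
  | _ n ih =>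
  subst hn
  by_cases hX0 : X = 0
  · exact ⟨0, Nat.zero_le _, Fin.elim0, Fin.elim0, fun k => k.elim0, fun j => by simp [hX0],
      fun k => k.elim0, fun k => k.elim0⟩
  obtain ⟨C, hC0, hCM, hCX, hCb⟩ := exists_nonneg_ker_vec M K hK1 hK X hX0 hX hM
  have hne : (Finset.univ.filter fun j => 0 < C j).Nonempty := by
    by_contra h
    simp only [Finset.not_nonempty_iff_eq_empty, Finset.filter_eq_empty_iff, Finset.mem_univ,
      not_lt, nonpos_iff_eq_zero, true_implies] at h
    exact hC0 (funext fun j => h (x := j))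
  obtain ⟨j₀, hj₀, hmin⟩ := Finset.exists_min_image _ (fun j => X j / C j) hne
  simp only [Finset.mem_filter, Finset.mem_univ, true_and] at hj₀ hmin
  have hc₀ : (0 : ℚ) < C j₀ := by exact_mod_cast hj₀
  set q := X j₀ / C j₀ with hq
  have hq0 : 0 ≤ q := div_nonneg (hX j₀) hc₀.le
  let Y : ι → ℚ := fun j => X j - q * C j
  have hlt : (Finset.univ.filter fun j => Y j ≠ 0).card <
      (Finset.univ.filter fun j => X j ≠ 0).card := by
    refine Finset.card_lt_card ⟨fun j hj => ?_, fun h => ?_⟩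
    · simp only [Finset.mem_filter, Finset.mem_univ, true_and] at hj ⊢
      exact fun h => hj (by simp [Y, h, hCX j h])
    · have hX₀ : X j₀ ≠ 0 := fun h => hj₀.ne' (hCX j₀ h)
      have := h (by simpa using hX₀ : j₀ ∈ _)
      simp [Y, hq, div_mul_cancel₀ _ hc₀.ne'] at this
  obtain ⟨t, ht, C', μ, hμ, hY, hker, hb⟩ := ih _ hlt Y
    (fun j => by
      change 0 ≤ X j - q * C j
      rcases Nat.eq_zero_or_pos (C j) with h | h
      · have := hX j
        simpa [h] using this
      · have h' : (0 : ℚ) < C j := by exact_mod_cast h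
        have := (le_div_iff₀ h').mp (hmin j h)
        linarith)
    (fun r => by
      have : ∑ j, (M r j : ℚ) * C j = 0 := by exact_mod_cast hCM r
      simp only [Y, mul_sub, Finset.sum_sub_distrib, hM r, mul_left_comm _ q, ← Finset.mul_sum,
        this]
      ring) rfl
  refine ⟨t + 1, by omega, Fin.cons C C', Fin.cons q μ, fun k => ?_, fun j => ?_, fun k => ?_,
    fun k => ?_⟩
  · refine Fin.cases ?_ (fun k => ?_) k
    · simpa using hq0
    · simpa using hμ k
  · rw [Fin.sum_univ_succ]
    simp only [Fin.cons_zero, Fin.cons_succ, ← hY j]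
    simp [Y]
  · refine Fin.cases ?_ (fun k => ?_) k
    · simpa using hCM
    · simpa using hker k
  · refine Fin.cases ?_ (fun k => ?_) k
    · simpa using hCb
    · simpa using hb k

end Kernel

/-! ### Linear polynomials under affine substitutions -/

namespace LinPoly

variable {n d t : ℕ}

@[simp] theorem coeff_add (p q : LinPoly n) (i : Fin n) :
    (p + q).coeff i = p.coeff i + q.coeff i := rfl

@[simp] theorem coeff_smul (a : ℤ) (p : LinPoly n) (i : Fin n) :
    (a • p).coeff i = a * p.coeff i := rfl

@[simp] theorem coeff_zero (i : Fin n) : (0 : LinPoly n).coeff i = 0 := rfl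

@[simp] theorem const_add (p q : LinPoly n) : (p + q).const = p.const + q.const := rfl

@[simp] theorem const_smul (a : ℤ) (p : LinPoly n) : (a • p).const = a * p.const := rfl

@[simp] theorem const_zero : (0 : LinPoly n).const = 0 := rfl

theorem ext_iff' {p q : LinPoly n} :
    p = q ↔ (∀ i, p.coeff i = q.coeff i) ∧ p.const = q.const := by
  rw [Prod.ext_iff, funext_iff]; rfl

@[simp] theorem eval_add (p q : LinPoly n) (x : Fin n → ℤ) :
    (p + q).eval x = p.eval x + q.eval x := by
  simp only [eval, coeff_add, const_add, add_mul, Finset.sum_add_distrib]; ring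

@[simp] theorem eval_smul (a : ℤ) (p : LinPoly n) (x : Fin n → ℤ) :
    (a • p).eval x = a * p.eval x := by
  simp only [eval, coeff_smul, const_smul, mul_add, Finset.mul_sum, mul_assoc]

/-- The polynomial `p(u + E y)` in the variables `y`. -/
def comp (p : LinPoly d) (u : Fin d → ℤ) (E : Matrix (Fin d) (Fin t) ℤ) : LinPoly t :=
  (fun k => ∑ j, p.coeff j * E j k, p.eval u)

theorem coeff_comp (p : LinPoly d) (u : Fin d → ℤ) (E : Matrix (Fin d) (Fin t) ℤ) (k : Fin t) :
    (p.comp u E).coeff k = ∑ j, p.coeff j * E j k := rfl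

theorem const_comp (p : LinPoly d) (u : Fin d → ℤ) (E : Matrix (Fin d) (Fin t) ℤ) :
    (p.comp u E).const = p.eval u := rfl

theorem eval_comp (p : LinPoly d) (u : Fin d → ℤ) (E : Matrix (Fin d) (Fin t) ℤ)
    (y : Fin t → ℤ) : (p.comp u E).eval y = p.eval (u + E.mulVec y) := by
  simp only [eval, coeff_comp, const_comp, Pi.add_apply, Matrix.mulVec, dotProduct, mul_add,
    Finset.sum_add_distrib, Finset.sum_mul, Finset.mul_sum]
  rw [Finset.sum_comm]
  simp only [mul_assoc]
  ring

/-- The polynomial `p(r + N y)`, for a vector `r` and an integer `N`. -/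
def dilate (N : ℤ) (r : Fin n → ℤ) (p : LinPoly n) : LinPoly n :=
  (fun k => N * p.coeff k, p.eval r)

@[simp] theorem coeff_dilate (N : ℤ) (r : Fin n → ℤ) (p : LinPoly n) (k : Fin n) :
    (p.dilate N r).coeff k = N * p.coeff k := rfl

@[simp] theorem const_dilate (N : ℤ) (r : Fin n → ℤ) (p : LinPoly n) :
    (p.dilate N r).const = p.eval r := rfl

theorem eval_dilate (N : ℤ) (r y : Fin n → ℤ) (p : LinPoly n) :
    (p.dilate N r).eval y = p.eval (r + N • y) := by
  simp only [eval, coeff_dilate, const_dilate, Pi.add_apply, Pi.smul_apply, smul_eq_mul, mul_add,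
    Finset.sum_add_distrib]
  have : ∀ i, p.coeff i * (N * y i) = N * p.coeff i * y i := fun i => by ring
  simp only [this]
  ring

theorem dilate_add (N : ℤ) (r : Fin n → ℤ) (p q : LinPoly n) :
    (p + q).dilate N r = p.dilate N r + q.dilate N r := by
  rw [ext_iff']; simp [mul_add]

theorem dilate_smul (N : ℤ) (r : Fin n → ℤ) (a : ℤ) (p : LinPoly n) :
    (a • p).dilate N r = a • p.dilate N r := by
  rw [ext_iff']
  simp only [coeff_dilate, const_dilate, coeff_smul, const_smul, eval_smul, mul_left_comm,
    implies_true, and_self]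

theorem isConstant_dilate {N : ℤ} (hN : N ≠ 0) {r : Fin n → ℤ} {p : LinPoly n} :
    (p.dilate N r).IsConstant ↔ p.IsConstant := by
  simp [IsConstant, hN]

theorem dilate_injective {N : ℤ} (hN : N ≠ 0) (r : Fin n → ℤ) :
    Function.Injective (dilate (n := n) N r) := by
  intro p q h
  rw [ext_iff'] at h ⊢
  have h1 : ∀ i, p.coeff i = q.coeff i := fun i => by simpa [hN] using h.1 i
  refine ⟨h1, ?_⟩
  have h2 := h.2
  simp only [const_dilate, eval, h1] at h2
  simpa using h2

theorem natAbs_eval_le (p : LinPoly n) (K B : ℕ) (hc : ∀ i, (p.coeff i).natAbs ≤ K)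
    (hk : p.const.natAbs ≤ K) (x : Fin n → ℤ) (hx : ∀ i, (x i).natAbs ≤ B) :
    (p.eval x).natAbs ≤ n * (K * B) + K := by
  refine (Int.natAbs_add_le _ _).trans (Nat.add_le_add ?_ hk)
  refine (Int.natAbs_sum_le _ _).trans ((Finset.sum_le_card_nsmul _ _ (K * B) fun i _ => ?_).trans
    (by simp))
  rw [Int.natAbs_mul]
  exact Nat.mul_le_mul (hc i) (hx i)

end LinPoly

/-! ### Integer points of polyhedra -/

/-- Every integer point of the polyhedron `{x | ∀ i, 0 ≤ pᵢ(x)}` is a small integer point of the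
polyhedron plus a non-negative integer combination of few small integer vectors of its recession
cone. The point is written, together with its slacks and a homogenizing coordinate, as a conic
combination of small kernel vectors; integral parts of the coefficients of the recession vectors
are split off. -/
theorem exists_polyhedron_decomposition {d : ℕ} {ρ : Type} [Fintype ρ] (p : ρ → LinPoly d)
    (K : ℕ) (hK1 : 1 ≤ K) (hcoeff : ∀ i j, ((p i).coeff j).natAbs ≤ K)
    (hconst : ∀ i, (p i).const.natAbs ≤ K) (x : Fin d → ℤ) (hx : ∀ i, 0 ≤ (p i).eval x)
    (n D : ℕ) (hn : n = 2 * d + Fintype.card ρ + 1) (hD : D = (n * K) ^ n) :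
    ∃ t ≤ n, ∃ (u : Fin d → ℤ) (E : Matrix (Fin d) (Fin t) ℤ) (lam : Fin t → ℕ),
      x = u + E.mulVec (fun k => (lam k : ℤ)) ∧ (∀ i, 0 ≤ (p i).eval u) ∧
      (∀ i k, 0 ≤ ∑ j, (p i).coeff j * E j k) ∧
      (∀ j, (u j).natAbs ≤ n * D) ∧ ∀ j k, (E j k).natAbs ≤ D := by
  classical
  let ι : Type := (Fin d ⊕ Fin d) ⊕ (ρ ⊕ Unit)
  let M : ρ → ι → ℤ := fun r => Sum.elim (Sum.elim (p r).coeff (fun j => -(p r).coeff j))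
    (Sum.elim (fun s => if s = r then -1 else 0) (fun _ => (p r).const))
  let X : ι → ℤ := Sum.elim (Sum.elim (fun j => (x j)⁺) (fun j => (x j)⁻))
    (Sum.elim (fun s => (p s).eval x) (fun _ => 1))
  have hMv : ∀ r (Y : ι → ℤ), ∑ j, M r j * Y j =
      ∑ j, (p r).coeff j * (Y (.inl (.inl j)) - Y (.inl (.inr j))) - Y (.inr (.inl r))
        + (p r).const * Y (.inr (.inr ())) := by
    intro r Y
    simp only [ι, M, Fintype.sum_sum_type, Sum.elim_inl, Sum.elim_inr, ite_mul, neg_mul,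
      Finset.sum_neg_distrib, one_mul, zero_mul, Finset.sum_ite_eq', Finset.mem_univ, if_true,
      mul_sub, Finset.sum_sub_distrib, Finset.univ_unique, Finset.sum_singleton]
    simp
    ring
  have hcardι : Fintype.card ι = n := by simp [ι, hn]; ring
  have hX0 : ∀ j, 0 ≤ X j := by
    rintro ((j | j) | (s | _))
    · exact posPart_nonneg _
    · exact negPart_nonneg _
    · exact hx s
    · exact zero_le_one
  have hXM : ∀ r, ∑ j, M r j * X j = 0 := fun r => by
    rw [hMv]
    simp [X, LinPoly.eval, posPart_sub_negPart]
  obtain ⟨t, ht, C, μ, hμ, hXC, hker, hCb⟩ := exists_conic_decomposition M K hK1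
    (by
      rintro r ((j | j) | (s | _))
      · exact hcoeff r j
      · simpa [M] using hcoeff r j
      · by_cases h : s = r <;> simp [M, h, hK1]
      · exact hconst r)
    (fun j => (X j : ℚ)) (fun j => by simpa using hX0 j)
    (fun r => by exact_mod_cast hXM r)
  rw [hcardι] at ht hCb
  rw [← hD] at hCb
  let τ : ι := .inr (.inr ())
  let lam : Fin t → ℕ := fun k => if C k τ = 0 then ⌊μ k⌋₊ else 0
  -- the part of `X` that remains after splitting off integral multiples of recession vectors
  let U : ι → ℤ := fun j => X j - ∑ k, (lam k : ℤ) * C k j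
  have hUq : ∀ j, (U j : ℚ) = ∑ k, (μ k - lam k) * C k j := fun j => by
    simp only [U, Int.cast_sub, hXC j, sub_mul, Finset.sum_sub_distrib]
    push_cast
    rfl
  have hlam0 : ∀ k, 0 ≤ μ k - lam k := fun k => by
    simp only [lam]
    split_ifs
    · exact sub_nonneg.mpr (Nat.floor_le (hμ k))
    · simpa using hμ k
  have hlam1 : ∀ k, μ k - lam k ≤ 1 := fun k => by
    simp only [lam]
    split_ifs with h
    · linarith [Nat.lt_floor_add_one (μ k)]
    · have h1 : (1 : ℚ) = ∑ k, μ k * C k τ := by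
        rw [← hXC τ]; simp [X, τ]
      have h2 : μ k * C k τ ≤ ∑ k, μ k * C k τ :=
        Finset.single_le_sum (f := fun k => μ k * C k τ)
          (fun k _ => mul_nonneg (hμ k) (Nat.cast_nonneg _)) (Finset.mem_univ k)
      have h3 : (1 : ℚ) ≤ C k τ := by exact_mod_cast Nat.one_le_iff_ne_zero.mpr h
      have h4 := mul_le_mul_of_nonneg_left h3 (hμ k)
      simp only [Nat.cast_zero, sub_zero]
      linarith
  have hU0 : ∀ j, 0 ≤ U j := fun j => by
    have : (0 : ℚ) ≤ U j := by
      rw [hUq]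
      exact Finset.sum_nonneg fun k _ => mul_nonneg (hlam0 k) (Nat.cast_nonneg _)
    exact_mod_cast this
  have hUb : ∀ j, U j ≤ n * D := fun j => by
    have : (U j : ℚ) ≤ n * D := by
      rw [hUq]
      refine (Finset.sum_le_card_nsmul _ _ (D : ℚ) fun k _ => ?_).trans ?_
      · have h1 : (C k j : ℚ) ≤ D := by exact_mod_cast hCb k j
        have h2 := mul_le_mul (hlam1 k) h1 (Nat.cast_nonneg _) zero_le_one
        linarith
      · rw [nsmul_eq_mul]
        refine mul_le_mul_of_nonneg_right ?_ (Nat.cast_nonneg _)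
        simpa using ht
    exact_mod_cast this
  have hUτ : U τ = 1 := by
    have : ∀ k, (lam k : ℤ) * C k τ = 0 := fun k => by
      by_cases h : C k τ = 0 <;> simp [lam, h]
    simp [U, this, X, τ]
  have hUM : ∀ r, ∑ j, M r j * U j = 0 := fun r => by
    simp only [U, mul_sub, Finset.sum_sub_distrib, hXM, Finset.mul_sum]
    rw [Finset.sum_comm]
    simp only [mul_left_comm (M r _), ← Finset.mul_sum, hker]
    simp
  refine ⟨t, ht, fun j => U (.inl (.inl j)) - U (.inl (.inr j)),
    fun j k => if C k τ = 0 then (C k (.inl (.inl j)) : ℤ) - C k (.inl (.inr j)) else 0, lam,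
    ?_, fun i => ?_, fun i k => ?_, fun j => ?_, fun j k => ?_⟩
  · funext j
    simp only [Pi.add_apply, Matrix.mulVec, dotProduct]
    have h1 : ∀ k, (if C k τ = 0 then (C k (.inl (.inl j)) : ℤ) - C k (.inl (.inr j)) else 0)
        * (lam k : ℤ) = lam k * C k (.inl (.inl j)) - lam k * C k (.inl (.inr j)) := fun k => by
      by_cases h : C k τ = 0
      · simp only [h, if_true]; ring
      · simp [lam, h]
    simp only [h1, Finset.sum_sub_distrib, U]
    have := posPart_sub_negPart (x j)
    simp only [X, Sum.elim_inl, Sum.elim_inr]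
    linarith
  · have := hUM i
    rw [hMv] at this
    have h1 : U (.inr (.inr ())) = 1 := hUτ
    rw [h1] at this
    have := hU0 (.inr (.inl i))
    simp only [LinPoly.eval]
    linarith
  · by_cases h : C k τ = 0
    · have h1 := hker k i
      rw [hMv] at h1
      have h2 : C k (.inr (.inr ())) = 0 := h
      rw [h2] at h1
      simp only [h, if_true]
      have : (0 : ℤ) ≤ C k (.inr (.inl i)) := Int.natCast_nonneg _
      push_cast at h1
      linarith
    · simp [h]
  · have h1 := hU0 (.inl (.inl j))
    have h2 := hU0 (.inl (.inr j))
    have h3 := hUb (.inl (.inl j))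
    have h4 := hUb (.inl (.inr j))
    change (U (.inl (.inl j)) - U (.inl (.inr j))).natAbs ≤ n * D
    have : ((n * D : ℕ) : ℤ) = n * D := by push_cast; rfl
    omega
  · have h1 := hCb k (.inl (.inl j))
    have h2 := hCb k (.inl (.inr j))
    change (if C k τ = 0 then (C k (.inl (.inl j)) : ℤ) - C k (.inl (.inr j)) else 0).natAbs ≤ D
    split_ifs
    · omega
    · simp

/-! ### The divisibility system encoding a family of GCD constraints -/

section Encoding

variable {t k : ℕ}

/-- The variables of the encoding: `t` variables `y`, and for each of `k` GCD constraints a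
variable `z` and a variable `w`. -/
def varEquiv (t k : ℕ) : Fin t ⊕ (Fin k ⊕ Fin k) ≃ Fin (t + (k + k)) :=
  (Equiv.sumCongr (Equiv.refl _) finSumFinEquiv).trans finSumFinEquiv

/-- The variable `yₛ`. -/
def yVar (k : ℕ) (s : Fin t) : Fin (t + (k + k)) := varEquiv t k (.inl s)

/-- The variable `zᵢ`. -/
def zVar (t : ℕ) (i : Fin k) : Fin (t + (k + k)) := varEquiv t k (.inr (.inl i))

/-- The variable `wᵢ`. -/
def wVar (t : ℕ) (i : Fin k) : Fin (t + (k + k)) := varEquiv t k (.inr (.inr i))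

theorem var_cases {motive : Fin (t + (k + k)) → Prop} (hy : ∀ s, motive (yVar k s))
    (hz : ∀ i, motive (zVar t i)) (hw : ∀ i, motive (wVar t i)) (x) : motive x := by
  rw [← (varEquiv t k).apply_symm_apply x]
  rcases (varEquiv t k).symm x with s | i | i
  exacts [hy s, hz i, hw i]

@[simp] theorem zVar_inj {i j : Fin k} : zVar t i = zVar t j ↔ i = j := by simp [zVar]

@[simp] theorem wVar_inj {i j : Fin k} : wVar t i = wVar t j ↔ i = j := by simp [wVar]

@[simp] theorem zVar_ne_wVar (i j : Fin k) : zVar t i ≠ wVar t j := by simp [zVar, wVar]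

@[simp] theorem wVar_ne_zVar (i j : Fin k) : wVar t i ≠ zVar t j := by simp [zVar, wVar]

@[simp] theorem yVar_ne_zVar (s : Fin t) (j : Fin k) : yVar k s ≠ zVar t j := by
  simp [zVar, yVar]

theorem sum_vars {α : Type} [AddCommMonoid α] (f : Fin (t + (k + k)) → α) :
    ∑ i, f i = ∑ s, f (yVar k s) + (∑ i, f (zVar t i) + ∑ i, f (wVar t i)) := by
  rw [← (varEquiv t k).sum_comp, Fintype.sum_sum_type, Fintype.sum_sum_type]
  rfl

namespace LinPoly

/-- A polynomial in the variables `y`, as a polynomial in all variables of the encoding. -/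
def lift (k : ℕ) (p : LinPoly t) : LinPoly (t + (k + k)) :=
  (fun i => Sum.elim p.coeff (fun _ => 0) ((varEquiv t k).symm i), p.const)

@[simp] theorem coeff_lift_y (p : LinPoly t) (s : Fin t) :
    (p.lift k).coeff (yVar k s) = p.coeff s := by simp [lift, yVar, coeff]

@[simp] theorem coeff_lift_z (p : LinPoly t) (i : Fin k) :
    (p.lift k).coeff (zVar t i) = 0 := by simp [lift, zVar, coeff]

@[simp] theorem coeff_lift_w (p : LinPoly t) (i : Fin k) :
    (p.lift k).coeff (wVar t i) = 0 := by simp [lift, wVar, coeff]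

@[simp] theorem const_lift (p : LinPoly t) : (p.lift k).const = p.const := rfl

theorem coeff_varAdd {n : ℕ} (i j : Fin n) (c : ℤ) :
    (varAdd i c).coeff j = if j = i then 1 else 0 := by
  simp [varAdd, coeff, Pi.single_apply]

@[simp] theorem const_varAdd {n : ℕ} (i : Fin n) (c : ℤ) : (varAdd i c).const = c := rfl

theorem varAdd_ne_zero {n : ℕ} (i : Fin n) (c : ℤ) : varAdd i c ≠ 0 := fun h => by
  have := congrArg (fun p : LinPoly n => p.coeff i) h
  simp [coeff_varAdd] at this

theorem eval_varAdd {n : ℕ} (i : Fin n) (c : ℤ) (x : Fin n → ℤ) :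
    (varAdd i c).eval x = x i + c := by
  simp [eval, coeff_varAdd]

theorem eval_lift (p : LinPoly t) (x : Fin (t + (k + k)) → ℤ) :
    (p.lift k).eval x = p.eval (fun s => x (yVar k s)) := by
  simp [eval, sum_vars]

theorem lift_add (p q : LinPoly t) : (p + q).lift k = p.lift k + q.lift k := by
  rw [ext_iff']
  exact ⟨var_cases (by simp) (by simp) (by simp), rfl⟩

theorem lift_smul (a : ℤ) (p : LinPoly t) : (a • p).lift k = a • p.lift k := by
  rw [ext_iff']
  refine ⟨var_cases ?_ ?_ ?_, rfl⟩ <;> intro i <;>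
    simp only [coeff_smul, coeff_lift_y, coeff_lift_z, coeff_lift_w, mul_zero]

theorem lift_injective : Function.Injective (lift (t := t) k) := by
  intro p q h
  rw [ext_iff'] at h ⊢
  exact ⟨fun s => by simpa using h.1 (yVar k s), h.2⟩

@[simp] theorem lift_zero : (0 : LinPoly t).lift k = 0 := by
  rw [ext_iff']
  exact ⟨var_cases (by simp) (by simp) (by simp), rfl⟩

theorem lift_ne_varAdd_w (p : LinPoly t) (i : Fin k) (c : ℤ) :
    p.lift k ≠ varAdd (wVar t i) c := fun h => by
  have := congrArg (fun p : LinPoly _ => p.coeff (wVar t i)) h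
  simp [coeff_varAdd] at this

theorem lift_ne_varAdd_z (p : LinPoly t) (i : Fin k) (c : ℤ) :
    p.lift k ≠ varAdd (zVar t i) c := fun h => by
  have := congrArg (fun p : LinPoly _ => p.coeff (zVar t i)) h
  simp [coeff_varAdd] at this

theorem varAdd_inj {n : ℕ} {i j : Fin n} {c e : ℤ} :
    varAdd i c = varAdd j e ↔ i = j ∧ c = e := by
  refine ⟨fun h => ⟨?_, congrArg LinPoly.const h⟩, fun ⟨h1, h2⟩ => h1 ▸ h2 ▸ rfl⟩
  have := congrArg (fun p : LinPoly _ => p.coeff i) h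
  by_contra hne
  simp [coeff_varAdd, hne] at this

end LinPoly

/-- Conditions on the greatest common divisors of `Fᵢ` and `Gᵢ`, for polynomials `Fᵢ, Gᵢ` in the
variables `y`. The kind `z` stands for `gcd(Fᵢ, Gᵢ) ≥ cᵢ`, to be expressed by
`zᵢ + cᵢ ∣ Fᵢ ∧ zᵢ + cᵢ ∣ Gᵢ`; the kind `w` stands for `gcd(Fᵢ, Gᵢ) ∣ cᵢ`, to be expressed by
`Fᵢ ∣ wᵢ ∧ Gᵢ ∣ wᵢ + cᵢ`; the kind `y` stands for no condition. -/
structure GcdFamily (t k : ℕ) where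
  F : Fin k → LinPoly t
  G : Fin k → LinPoly t
  kind : Fin k → Family
  c : Fin k → ℤ

namespace GcdFamily

variable (D : GcdFamily t k)

/-- The divisibility constraints that express the `i`-th condition. -/
def constraints (i : Fin k) : DivSystem (t + (k + k)) :=
  match D.kind i with
  | .z => [⟨.varAdd (zVar t i) (D.c i), (D.F i).lift k⟩,
      ⟨.varAdd (zVar t i) (D.c i), (D.G i).lift k⟩]
  | .w => [⟨(D.F i).lift k, .varAdd (wVar t i) 0⟩, ⟨(D.G i).lift k, .varAdd (wVar t i) (D.c i)⟩]
  | .y => []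

/-- The system of divisibility constraints that expresses all conditions. -/
def system : DivSystem (t + (k + k)) := (List.finRange k).flatMap D.constraints

variable {D}

theorem forall_mem_system {P : DivConstraint (t + (k + k)) → Prop} :
    (∀ δ ∈ D.system, P δ) ↔ ∀ i,
      (D.kind i = .z → P ⟨.varAdd (zVar t i) (D.c i), (D.F i).lift k⟩ ∧
        P ⟨.varAdd (zVar t i) (D.c i), (D.G i).lift k⟩) ∧
      (D.kind i = .w → P ⟨(D.F i).lift k, .varAdd (wVar t i) 0⟩ ∧
        P ⟨(D.G i).lift k, .varAdd (wVar t i) (D.c i)⟩) := by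
  have h1 : (∀ δ ∈ D.system, P δ) ↔ ∀ i, ∀ δ ∈ D.constraints i, P δ := by
    simp only [system, List.mem_flatMap, List.mem_finRange, true_and]
    exact ⟨fun h i δ hδ => h δ ⟨i, hδ⟩, fun h δ ⟨i, hδ⟩ => h i δ hδ⟩
  rw [h1]
  refine forall_congr' fun i => ?_
  unfold constraints
  cases hk : D.kind i <;> simp

/-! ### The encoding is 3-increasing -/

theorem divModule_le {f : LinPoly (t + (k + k))} {S : Submodule ℤ (LinPoly (t + (k + k)))}
    (hf : f ∈ S)
    (hz : ∀ i, D.kind i = .z → ∀ b : ℤ, b • LinPoly.varAdd (zVar t i) (D.c i) ∈ S →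
      b • (D.F i).lift k ∈ S ∧ b • (D.G i).lift k ∈ S)
    (hw : ∀ i, D.kind i = .w → ∀ b : ℤ,
      (b • (D.F i).lift k ∈ S → b • LinPoly.varAdd (wVar t i) 0 ∈ S) ∧
      (b • (D.G i).lift k ∈ S → b • LinPoly.varAdd (wVar t i) (D.c i) ∈ S)) :
    D.system.divModule f ≤ S := by
  refine sInf_le ⟨hf, forall_mem_system.mpr fun i => ⟨fun hi => ?_, fun hi => ?_⟩⟩
  · exact ⟨fun b hb => (hz i hi b hb).1, fun b hb => (hz i hi b hb).2⟩
  · exact ⟨fun b hb => (hw i hi b).1 hb, fun b hb => (hw i hi b).2 hb⟩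

/-- Let `U` be a module of polynomials without variables `w` that is closed under the constraints
with left-hand sides `zᵢ + cᵢ`. If for no condition of kind `w` non-zero multiples of both `Fᵢ` and
`Gᵢ` are in `U`, then the divisibility module of a member of `U` is contained in the sum of `U` and
multiples of one of `wᵢ`, `wᵢ + cᵢ` for each `i`; thus its members without variables `w` are
in `U`. -/
theorem mem_of_mem_divModule {f g : LinPoly (t + (k + k))}
    (U : Submodule ℤ (LinPoly (t + (k + k)))) (hU : ∀ g ∈ U, ∀ i, g.coeff (wVar t i) = 0)
    (hf : f ∈ U)
    (hz : ∀ i, D.kind i = .z → ∀ b : ℤ, b • LinPoly.varAdd (zVar t i) (D.c i) ∈ U →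
      b • (D.F i).lift k ∈ U ∧ b • (D.G i).lift k ∈ U)
    (hw : ∀ i, D.kind i = .w → ¬ ((∃ b : ℤ, b ≠ 0 ∧ b • (D.F i).lift k ∈ U) ∧
      ∃ b : ℤ, b ≠ 0 ∧ b • (D.G i).lift k ∈ U))
    (hg : g ∈ D.system.divModule f) (hgw : ∀ i, g.coeff (wVar t i) = 0) : g ∈ U := by
  classical
  let ω : Fin k → LinPoly (t + (k + k)) := fun i =>
    .varAdd (wVar t i) (if ∃ b : ℤ, b ≠ 0 ∧ b • (D.F i).lift k ∈ U then 0 else D.c i)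
  let T := U ⊔ Submodule.span ℤ (Set.range ω)
  have hωT : ∀ i (b : ℤ), b • ω i ∈ T := fun i b =>
    T.smul_mem b (Submodule.mem_sup_right (Submodule.subset_span ⟨i, rfl⟩))
  have key : ∀ h ∈ T, (∀ i, h.coeff (wVar t i) = 0) → h ∈ U := by
    intro h hT hw0
    obtain ⟨a, ha, s, hs, rfl⟩ := Submodule.mem_sup.mp hT
    obtain ⟨e, rfl⟩ := (Submodule.mem_span_range_iff_exists_fun ℤ).mp hs
    have hcoeff : ∀ j, (∑ i, e i • ω i).coeff (wVar t j) = e j := by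
      intro j
      have : ∀ p : LinPoly (t + (k + k)), p.coeff (wVar t j) =
          (LinearMap.proj (R := ℤ) (wVar t j) ∘ₗ LinearMap.fst ℤ _ ℤ) p := fun p => rfl
      rw [this, map_sum]
      simp only [← this, LinPoly.coeff_smul, ω, LinPoly.coeff_varAdd, wVar_inj]
      simp
    have he : ∀ j, e j = 0 := fun j => by
      have h1 := hw0 j
      rw [LinPoly.coeff_add, hU a ha, hcoeff] at h1
      simpa using h1
    simpa [he] using ha
  refine key g (divModule_le (Submodule.mem_sup_left hf) ?_ ?_ hg) hgw
  · intro i hi b hb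
    have hbU := key _ hb fun j => by
      rw [LinPoly.coeff_smul, LinPoly.coeff_varAdd]; simp
    exact ⟨Submodule.mem_sup_left (hz i hi b hbU).1, Submodule.mem_sup_left (hz i hi b hbU).2⟩
  · intro i hi b
    rcases eq_or_ne b 0 with rfl | hb0
    · simp
    refine ⟨fun hb => ?_, fun hb => ?_⟩
    · have hbU := key _ hb fun j => by rw [LinPoly.coeff_smul]; simp
      have := hωT i b
      simp only [ω] at this
      rwa [if_pos ⟨b, hb0, hbU⟩] at this
    · have hbU := key _ hb fun j => by rw [LinPoly.coeff_smul]; simp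
      have := hωT i b
      simp only [ω] at this
      rwa [if_neg fun hF => hw i hi ⟨hF, ⟨b, hb0, hbU⟩⟩] at this

theorem eq_zero_of_smul_eq_smul {n : ℕ} {l f : LinPoly n} {x : Fin n} {a b : ℤ}
    (hfx : f.coeff x ≠ 0) (hlx : l.coeff x = 0) (hl : l ≠ 0) (h : a • f = b • l) : b = 0 := by
  have h1 := congrArg (fun p : LinPoly n => p.coeff x) h
  simp only [LinPoly.coeff_smul, hlx, mul_zero, mul_eq_zero, hfx, or_false] at h1
  subst h1
  rw [zero_smul] at h
  exact (smul_eq_zero.mp h.symm).resolve_right hl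

/-- Conditions under which the encoding is 3-increasing: for the kind `z` there is no non-zero
constant in the span of `Fᵢ` and `Gᵢ`; for the kind `w`, non-constant `Fⱼ` and `Gⱼ` are not
proportional; and `Fⱼ`, `Gⱼ` of kind `w` are never both in the rational span of `Fᵢ`, `Gᵢ` of
kind `z`. -/
structure Independent (D : GcdFamily t k) : Prop where
  ne_zero : ∀ j, D.kind j = .w → D.F j ≠ 0 ∧ D.G j ≠ 0
  eq_zero_of_isConstant : ∀ i, D.kind i = .z → ∀ α β : ℤ,
    (α • D.F i + β • D.G i).IsConstant → α • D.F i + β • D.G i = 0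
  isConstant_of_smul_eq : ∀ j, D.kind j = .w → ∀ p q : ℤ, p ≠ 0 → q ≠ 0 →
    p • D.F j = q • D.G j → (D.F j).IsConstant
  not_span : ∀ i j, D.kind i = .z → D.kind j = .w →
    ¬ ((∃ b α β : ℤ, b ≠ 0 ∧ b • D.F j = α • D.F i + β • D.G i) ∧
      ∃ b α β : ℤ, b ≠ 0 ∧ b • D.G j = α • D.F i + β • D.G i)

/-- The classes of the variables: the `z` come first, then the `y`, then the `w`. -/
def part (x : Fin (t + (k + k))) : Fin 3 :=
  Sum.elim (fun _ => 1) (Sum.elim (fun _ => 0) (fun _ => 2)) ((varEquiv t k).symm x)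

@[simp] theorem part_yVar (s : Fin t) : part (yVar k s) = 1 := by simp [part, yVar]

@[simp] theorem part_zVar (i : Fin k) : part (zVar t i) = 0 := by simp [part, zVar]

@[simp] theorem part_wVar (i : Fin k) : part (wVar t i) = 2 := by simp [part, wVar]

/-- The module `U` of `mem_of_mem_divModule` is spanned by `f`, and by `Fᵢ` and `Gᵢ` if `f` is
proportional to `zᵢ + cᵢ`. -/
theorem isRIncreasing (hD : D.Independent) : D.system.IsRIncreasing 3 := by
  refine ⟨part, fun lt hlt hpart f x _ hfx => Set.Subset.antisymm ?_ ?_⟩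
  swap
  · rintro g ⟨b, rfl⟩
    refine ⟨Submodule.smul_mem _ b (Submodule.mem_sInf.mpr fun M hM => hM.1), fun y hy => ?_⟩
    exact hfx.2 y (right_ne_zero_of_mul (by simpa only [LinPoly.coeff_smul] using hy))
  rintro g ⟨hg, hgx⟩
  -- variables of later classes than `x` occur neither in `f` nor in `g`
  have hlate : ∀ p : LinPoly (t + (k + k)), p.VarsIn {y | y = x ∨ lt y x} →
      ∀ y, part x < part y → p.coeff y = 0 := by
    intro p hp y hxy
    by_contra h
    rcases hp y h with rfl | h
    · exact lt_irrefl _ hxy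
    · exact hlt.toIsStrictOrder.toIrrefl.irrefl x
        (hlt.toIsStrictOrder.toIsTrans.trans _ _ _ (hpart _ _ hxy) h)
  have hfl := hlate f hfx.2
  have hgl := hlate g hgx
  have hfx0 := hfx.1
  suffices g ∈ Submodule.span ℤ {f} by
    obtain ⟨b, hb⟩ := Submodule.mem_span_singleton.mp this
    exact ⟨b, hb.symm⟩
  have hspan : ∀ {h : LinPoly (t + (k + k))}, h ∈ Submodule.span ℤ {f} ↔ ∃ a : ℤ, a • f = h :=
    Submodule.mem_span_singleton
  have hf0 : f ∈ Submodule.span ℤ {f} := Submodule.mem_span_singleton_self f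
  have hlift : ∀ {p : LinPoly t}, p ≠ 0 → p.lift k ≠ 0 := fun hp h =>
    hp (LinPoly.lift_injective (k := k) (by rw [h, LinPoly.lift_zero]))
  have hzero : ∀ {b : ℤ} {p : LinPoly (t + (k + k))}, b = 0 →
      b • p ∈ Submodule.span ℤ {f} := fun h => by simp [h]
  revert hfl hgl hfx0
  clear hlate hgx hpart hfx
  refine var_cases (motive := fun x => (∀ y, part x < part y → f.coeff y = 0) →
    (∀ y, part x < part y → g.coeff y = 0) → f.coeff x ≠ 0 → g ∈ Submodule.span ℤ {f})
    (fun s hfl hgl hfx => ?_) (fun i hfl hgl hfx => ?_) (fun i hfl hgl hfx => ?_) x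
  · -- the leading variable is one of the `y`
    refine mem_of_mem_divModule (Submodule.span ℤ {f}) ?_ hf0 ?_ ?_ hg
      fun i => hgl _ (by simp)
    · rintro h hh i
      obtain ⟨a, rfl⟩ := hspan.mp hh
      simp only [LinPoly.coeff_smul, hfl (wVar t i) (by simp), mul_zero]
    · intro i _ b hb
      obtain ⟨a, ha⟩ := hspan.mp hb
      have hb0 := eq_zero_of_smul_eq_smul hfx (by simp [LinPoly.coeff_varAdd])
        (LinPoly.varAdd_ne_zero _ _) ha
      exact ⟨hzero hb0, hzero hb0⟩
    · rintro j hj ⟨⟨b, hb0, hb⟩, b', hb0', hb'⟩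
      obtain ⟨a, ha⟩ := hspan.mp hb
      obtain ⟨a', ha'⟩ := hspan.mp hb'
      have hane : a ≠ 0 := by
        rintro rfl
        rw [zero_smul] at ha
        exact (smul_ne_zero hb0 (hlift (hD.ne_zero j hj).1)) ha.symm
      have hane' : a' ≠ 0 := by
        rintro rfl
        rw [zero_smul] at ha'
        exact (smul_ne_zero hb0' (hlift (hD.ne_zero j hj).2)) ha'.symm
      have hc := hD.isConstant_of_smul_eq j hj (a' * b) (a * b') (mul_ne_zero hane' hb0)
        (mul_ne_zero hane hb0') (LinPoly.lift_injective (k := k) (by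
          rw [LinPoly.lift_smul, LinPoly.lift_smul, mul_smul, mul_smul, ← ha, ← ha',
            smul_comm]))
      have h1 := congrArg (fun p : LinPoly _ => p.coeff (yVar k s)) ha
      simp only [LinPoly.coeff_smul, LinPoly.coeff_lift_y, hc s, mul_zero, mul_eq_zero, hane,
        hfx, or_self] at h1
  · -- the leading variable is one of the `z`
    have hwf : ∀ j, f.coeff (wVar t j) = 0 := fun j => hfl _ (by simp)
    by_cases hmul : ∃ i', D.kind i' = .z ∧ ∃ b : ℤ, b ≠ 0 ∧
        b • LinPoly.varAdd (zVar t i') (D.c i') ∈ Submodule.span ℤ {f}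
    · -- `f` is proportional to some `z + c`
      obtain ⟨i', hi', b, hb0, hb⟩ := hmul
      obtain ⟨a, ha⟩ := hspan.mp hb
      have hane : a ≠ 0 := by
        rintro rfl
        rw [zero_smul] at ha
        exact (smul_ne_zero hb0 (LinPoly.varAdd_ne_zero _ _)) ha.symm
      have hfz : ∀ y, y ≠ zVar t i' → f.coeff y = 0 := fun y hy => by
        have h1 := congrArg (fun p : LinPoly _ => p.coeff y) ha
        simpa only [LinPoly.coeff_smul, LinPoly.coeff_varAdd, hy, if_false, mul_zero, mul_eq_zero,
          hane, false_or] using h1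
      have hii : i = i' := by
        by_contra h
        exact hfx (hfz _ (by simpa using h))
      subst hii
      let U := Submodule.span ℤ {f, (D.F i).lift k, (D.G i).lift k}
      have hU : ∀ {h}, h ∈ U ↔ ∃ r α β : ℤ,
          r • f + (α • D.F i + β • D.G i).lift k = h := by
        intro h
        simp only [U, Submodule.mem_span_triple, LinPoly.lift_add, LinPoly.lift_smul, add_assoc]
      have hFU : (D.F i).lift k ∈ U := Submodule.subset_span (by simp)
      have hGU : (D.G i).lift k ∈ U := Submodule.subset_span (by simp)
      -- members of `U` without `z` are combinations of `F` and `G`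
      have hUy : ∀ {b : ℤ} {p : LinPoly t}, b • p.lift k ∈ U →
          ∃ α β : ℤ, b • p = α • D.F i + β • D.G i := by
        intro b p hp
        obtain ⟨r, α, β, h⟩ := hU.mp hp
        have h1 := congrArg (fun p : LinPoly _ => p.coeff (zVar t i)) h
        simp only [LinPoly.coeff_smul, LinPoly.coeff_add, LinPoly.coeff_lift_z, mul_zero,
          add_zero, mul_eq_zero, hfx, or_false] at h1
        subst h1
        refine ⟨α, β, LinPoly.lift_injective (k := k) ?_⟩
        rw [LinPoly.lift_smul, ← h, zero_smul, zero_add]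
      have hgU : g ∈ U := by
        refine mem_of_mem_divModule U ?_ (Submodule.subset_span (by simp)) ?_ ?_ hg
          fun j => hgl _ (by simp)
        · intro h hh j
          obtain ⟨r, α, β, rfl⟩ := hU.mp hh
          simp only [LinPoly.coeff_add, LinPoly.coeff_smul, hwf, LinPoly.coeff_lift_w, mul_zero,
            add_zero]
        · intro l _ b' hb'
          by_cases hl : l = i
          · subst hl
            exact ⟨U.smul_mem _ hFU, U.smul_mem _ hGU⟩
          · obtain ⟨r, α, β, h⟩ := hU.mp hb'
            have h1 := congrArg (fun p : LinPoly _ => p.coeff (zVar t l)) h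
            simp only [LinPoly.coeff_add, LinPoly.coeff_smul, hfz (zVar t l) (by simpa using hl),
              LinPoly.coeff_lift_z, mul_zero, add_zero, LinPoly.coeff_varAdd, if_true,
              mul_one] at h1
            subst h1
            simp
        · rintro j hj ⟨⟨b₁, hb₁, h₁⟩, b₂, hb₂, h₂⟩
          obtain ⟨α₁, β₁, h₁⟩ := hUy h₁
          obtain ⟨α₂, β₂, h₂⟩ := hUy h₂
          exact hD.not_span i j hi' hj ⟨⟨b₁, α₁, β₁, hb₁, h₁⟩, b₂, α₂, β₂, hb₂, h₂⟩
      obtain ⟨r, α, β, h⟩ := hU.mp hgU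
      have hconst : (α • D.F i + β • D.G i).IsConstant := fun s => by
        have h1 := hgl (yVar k s) (by simp)
        rw [← h, LinPoly.coeff_add, LinPoly.coeff_lift_y, LinPoly.coeff_smul,
          hfz _ (by simp), mul_zero, zero_add] at h1
        exact h1
      rw [hD.eq_zero_of_isConstant i hi' α β hconst, LinPoly.lift_zero, add_zero] at h
      exact hspan.mpr ⟨r, h⟩
    · push Not at hmul
      refine mem_of_mem_divModule (Submodule.span ℤ {f}) ?_ hf0 ?_ ?_ hg fun j => hgl _ (by simp)
      · rintro h hh j
        obtain ⟨a, rfl⟩ := hspan.mp hh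
        simp only [LinPoly.coeff_smul, hwf, mul_zero]
      · intro l hl b hb
        have hb0 : b = 0 := by
          by_contra h
          exact hmul l hl b h hb
        exact ⟨hzero hb0, hzero hb0⟩
      · rintro j hj ⟨⟨b, hb0, hb⟩, -⟩
        obtain ⟨a, ha⟩ := hspan.mp hb
        exact hb0 (eq_zero_of_smul_eq_smul hfx (by simp) (hlift (hD.ne_zero j hj).1) ha)
  · -- the leading variable is one of the `w`: no left-hand side is proportional to `f`
    refine divModule_le hf0 ?_ ?_ hg
    · intro l _ b hb
      obtain ⟨a, ha⟩ := hspan.mp hb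
      have hb0 := eq_zero_of_smul_eq_smul hfx (by simp [LinPoly.coeff_varAdd])
        (LinPoly.varAdd_ne_zero _ _) ha
      exact ⟨hzero hb0, hzero hb0⟩
    · intro j hj b
      refine ⟨fun hb => ?_, fun hb => ?_⟩
      · obtain ⟨a, ha⟩ := hspan.mp hb
        exact hzero (eq_zero_of_smul_eq_smul hfx (by simp) (hlift (hD.ne_zero j hj).1) ha)
      · obtain ⟨a, ha⟩ := hspan.mp hb
        exact hzero (eq_zero_of_smul_eq_smul hfx (by simp) (hlift (hD.ne_zero j hj).2) ha)

end GcdFamily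

end Encoding

section Encoding

variable {t k d : ℕ}

namespace GcdFamily

variable {D : GcdFamily t k}

/-! ### Solutions of the encoding -/

theorem existsUnique_eq_mul_iff {a b : ℤ} : (∃! q : ℤ, b = q * a) ↔ a ≠ 0 ∧ a ∣ b := by
  constructor
  · rintro ⟨q, hq, huniq⟩
    refine ⟨?_, q, by rw [mul_comm]; exact hq⟩
    rintro rfl
    have := huniq (q + 1) (by simpa using hq)
    omega
  · rintro ⟨ha, q, rfl⟩
    exact ⟨q, mul_comm _ _, fun r hr => mul_right_cancel₀ ha (by rw [← hr, mul_comm])⟩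

theorem isSolution_system_iff {x : Fin (t + (k + k)) → ℤ} :
    D.system.IsSolution x ↔ ∀ i,
      (D.kind i = .z → x (zVar t i) + D.c i ≠ 0 ∧
        x (zVar t i) + D.c i ∣ (D.F i).eval (fun s => x (yVar k s)) ∧
        x (zVar t i) + D.c i ∣ (D.G i).eval (fun s => x (yVar k s))) ∧
      (D.kind i = .w →
        ((D.F i).eval (fun s => x (yVar k s)) ≠ 0 ∧ (D.G i).eval (fun s => x (yVar k s)) ≠ 0) ∧
        (D.F i).eval (fun s => x (yVar k s)) ∣ x (wVar t i) ∧
        (D.G i).eval (fun s => x (yVar k s)) ∣ x (wVar t i) + D.c i) := by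
  unfold DivSystem.IsSolution
  rw [forall_mem_system]
  refine forall_congr' fun i => ?_
  simp only [existsUnique_eq_mul_iff, LinPoly.eval_varAdd, LinPoly.eval_lift, add_zero]
  tauto

/-- A point whose greatest common divisors are as required extends to a solution; for the kind
`w`, the value of `wᵢ` comes from a Bézout identity. -/
theorem exists_isSolution (y : Fin t → ℕ)
    (hz : ∀ i, D.kind i = .z →
      0 < D.c i ∧ D.c i ≤ Int.gcd ((D.F i).eval fun s => y s) ((D.G i).eval fun s => y s))
    (hw : ∀ i, D.kind i = .w →
      (0 < (D.F i).eval (fun s => y s) ∧ 0 < (D.G i).eval (fun s => y s)) ∧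
      (Int.gcd ((D.F i).eval fun s => y s) ((D.G i).eval fun s => y s) : ℤ) = D.c i) :
    ∃ lam : Fin (t + (k + k)) → ℕ, (∀ s, lam (yVar k s) = y s) ∧
      D.system.IsSolution (fun i => (lam i : ℤ)) := by
  have hex : ∀ i, ∃ w : ℕ, D.kind i = .w →
      (D.F i).eval (fun s => y s) ∣ w ∧ (D.G i).eval (fun s => y s) ∣ w + D.c i := by
    intro i
    by_cases hi : D.kind i = .w
    · obtain ⟨⟨hF, hG⟩, hgcd⟩ := hw i hi
      set f := (D.F i).eval fun s => y s
      set g := (D.G i).eval fun s => y s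
      have hbez := Int.gcd_eq_gcd_ab f g
      set a := Int.gcdA f g
      set b := Int.gcdB f g
      -- `-f a` is shifted by a multiple of `f g` to become non-negative
      have hnn : 0 ≤ f * (|a| * g - a) := by
        refine mul_nonneg hF.le ?_
        nlinarith [le_abs_self a, abs_nonneg a]
      refine ⟨(f * (|a| * g - a)).toNat, fun _ => ?_⟩
      rw [Int.toNat_of_nonneg hnn]
      refine ⟨dvd_mul_right _ _, f * |a| + b, ?_⟩
      rw [← hgcd, hbez]
      ring
    · exact ⟨0, fun h => absurd h hi⟩
  choose w hw' using hex
  let z : Fin k → ℕ := fun i =>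
    (Int.gcd ((D.F i).eval fun s => y s) ((D.G i).eval fun s => y s) - D.c i).toNat
  let lam : Fin (t + (k + k)) → ℕ := fun x => Sum.elim y (Sum.elim z w) ((varEquiv t k).symm x)
  have hly : ∀ s, lam (yVar k s) = y s := fun s => by simp [lam, yVar]
  have hlz : ∀ i, lam (zVar t i) = z i := fun s => by simp [lam, zVar]
  have hlw : ∀ i, lam (wVar t i) = w i := fun s => by simp [lam, wVar]
  refine ⟨lam, hly, isSolution_system_iff.mpr fun i => ⟨fun hi => ?_, fun hi => ?_⟩⟩
  · obtain ⟨hc0, hle⟩ := hz i hi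
    have hzi : (z i : ℤ) + D.c i =
        Int.gcd ((D.F i).eval fun s => y s) ((D.G i).eval fun s => y s) := by
      simp only [z]
      rw [Int.toNat_of_nonneg (by linarith)]
      ring
    simp only [hlz, hly, hzi]
    exact ⟨by linarith, Int.gcd_dvd_left _ _, Int.gcd_dvd_right _ _⟩
  · simp only [hlw, hly]
    exact ⟨⟨(hw i hi).1.1.ne', (hw i hi).1.2.ne'⟩, hw' i hi⟩

/-! ### The triple of the encoding -/

/-- The triple with the divisibility system of `D` and the substitution `x = u + E y`. -/
def triple (D : GcdFamily t k) (u : Fin d → ℤ) (E : Matrix (Fin d) (Fin t) ℤ) : Triple d where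
  m := t + (k + k)
  Ψ := D.system
  u := u
  E := fun j i => Sum.elim (E j) (fun _ => 0) ((varEquiv t k).symm i)

theorem mulVec_triple (u : Fin d → ℤ) (E : Matrix (Fin d) (Fin t) ℤ)
    (x : Fin (t + (k + k)) → ℤ) :
    (D.triple u E).E.mulVec x = E.mulVec (fun s => x (yVar k s)) := by
  funext j
  simp only [Matrix.mulVec, dotProduct]
  refine (sum_vars _).trans ?_
  simp [triple, yVar, zVar, wVar]

theorem count_flatMap_finRange {α : Type} [BEq α] (L : Fin k → List α) (a : α) :
    ((List.finRange k).flatMap L).count a = ∑ i, (L i).count a := by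
  rw [List.count_flatMap, Fin.sum_univ_def]
  rfl

theorem isGcdToDiv (u : Fin d → ℤ) (E : Matrix (Fin d) (Fin t) ℤ)
    (hc : ∀ i, D.kind i ≠ .y → 0 < D.c i) (hF : ∀ i, (D.F i).IsNonneg)
    (hG : ∀ i, (D.G i).IsNonneg)
    (hw : ∀ i, D.kind i = .w → 0 < (D.F i).const ∧ 0 < (D.G i).const) :
    (D.triple u E).IsGcdToDiv := by
  classical
  let κ : Fin (t + (k + k)) → Family := fun x =>
    Sum.elim (fun _ => .y) (Sum.elim (fun i => if D.kind i = .z then .z else .y)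
      (fun i => if D.kind i = .w then .w else .y)) ((varEquiv t k).symm x)
  have κy : ∀ s, κ (yVar k s) = .y := fun s => by simp [κ, yVar]
  have κz : ∀ i, κ (zVar t i) = if D.kind i = .z then .z else .y := fun s => by simp [κ, zVar]
  have κw : ∀ i, κ (wVar t i) = if D.kind i = .w then .w else .y := fun s => by simp [κ, wVar]
  have hlift : ∀ p : LinPoly t, (p.lift k).VarsIn {i | κ i = .y} := fun p =>
    var_cases (fun s _ => κy s) (fun i hi => by simp at hi) (fun i hi => by simp at hi)
  have hliftnn : ∀ p : LinPoly t, p.IsNonneg → (p.lift k).IsNonneg := fun p hp =>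
    ⟨var_cases (fun s => by simpa using hp.1 s) (by simp) (by simp), hp.2⟩
  have hvarnn : ∀ (i : Fin (t + (k + k))) (c : ℤ), 0 ≤ c → (LinPoly.varAdd i c).IsNonneg := by
    refine fun i c hc => ⟨fun j => ?_, hc⟩
    rw [LinPoly.coeff_varAdd]
    split_ifs <;> simp
  have hvarin : ∀ (i : Fin (t + (k + k))) (c : ℤ) (S : Set (Fin (t + (k + k)))), i ∈ S →
      (LinPoly.varAdd i c).VarsIn S := by
    intro i c S hi j hj
    rw [LinPoly.coeff_varAdd] at hj
    by_cases h : j = i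
    · exact h ▸ hi
    · simp [h] at hj
  have hterm : ∀ {P : LinPoly (t + (k + k)) → Prop},
      (∀ δ ∈ D.system, P δ.lhs ∧ P δ.rhs) → ∀ f, D.system.IsTerm f → P f := by
    rintro P h f ⟨δ, hδ, rfl | rfl⟩
    exacts [(h δ hδ).1, (h δ hδ).2]
  have h2 : ∀ i, κ i = .z → ∃ c : ℤ, 0 < c ∧
      (∀ f, D.system.IsTerm f → f.coeff i ≠ 0 → f = LinPoly.varAdd i c) ∧
      (D.system.map DivConstraint.lhs).count (LinPoly.varAdd i c) = 2 := by
    refine var_cases (fun s h => ?_) (fun i h => ?_) (fun i h => ?_)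
    · simp [κy] at h
    · have hi : D.kind i = .z := by
        by_contra h'
        simp [κz, h'] at h
      refine ⟨D.c i, hc i (by simp [hi]), hterm (forall_mem_system.mpr fun l => ?_), ?_⟩
      · have hz : (LinPoly.varAdd (zVar t l) (D.c l)).coeff (zVar t i) ≠ 0 →
            LinPoly.varAdd (zVar t l) (D.c l) = LinPoly.varAdd (zVar t i) (D.c i) := by
          intro hl
          have : i = l := by simpa [LinPoly.coeff_varAdd] using hl
          rw [this]
        refine ⟨fun _ => ⟨⟨hz, ?_⟩, hz, ?_⟩, fun _ => ⟨⟨?_, ?_⟩, ?_, ?_⟩⟩ <;>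
          simp [LinPoly.coeff_varAdd]
      · rw [system, List.map_flatMap, count_flatMap_finRange, Finset.sum_eq_single i]
        · simp [constraints, hi]
        · intro l _ hl
          unfold constraints
          cases D.kind l <;>
            simp [LinPoly.varAdd_inj, hl, LinPoly.lift_ne_varAdd_z]
        · simp
    · by_cases h' : D.kind i = .w <;> simp [κw, h'] at h
  have h3 : ∀ i, κ i = .w → ∃ c : ℤ, 0 < c ∧
      (∀ f, D.system.IsTerm f → f.coeff i ≠ 0 →
        f = LinPoly.varAdd i 0 ∨ f = LinPoly.varAdd i c) ∧
      (D.system.map DivConstraint.rhs).count (LinPoly.varAdd i 0) = 1 ∧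
      (D.system.map DivConstraint.rhs).count (LinPoly.varAdd i c) = 1 := by
    refine var_cases (fun s h => ?_) (fun i h => ?_) (fun i h => ?_)
    · simp [κy] at h
    · by_cases h' : D.kind i = .z <;> simp [κz, h'] at h
    · have hi : D.kind i = .w := by
        by_contra h'
        simp [κw, h'] at h
      have hci := hc i (by simp [hi])
      refine ⟨D.c i, hci, hterm (forall_mem_system.mpr fun l => ?_), ?_, ?_⟩
      · have hl : ∀ c, (LinPoly.varAdd (wVar t l) c).coeff (wVar t i) ≠ 0 → i = l := by
          intro c hl
          simpa [LinPoly.coeff_varAdd] using hl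
        refine ⟨fun _ => ⟨⟨?_, ?_⟩, ?_, ?_⟩, fun _ => ⟨⟨?_, fun h => ?_⟩, ?_, fun h => ?_⟩⟩
        · simp [LinPoly.coeff_varAdd]
        · simp
        · simp [LinPoly.coeff_varAdd]
        · simp
        · simp
        · exact .inl (by simp [hl _ h])
        · simp
        · exact .inr (by simp [hl _ h])
      · rw [system, List.map_flatMap, count_flatMap_finRange, Finset.sum_eq_single i]
        · simp [constraints, hi, LinPoly.varAdd_inj, hci.ne']
        · intro l _ hl
          unfold constraints
          cases D.kind l <;>
            simp [LinPoly.varAdd_inj, hl, LinPoly.lift_ne_varAdd_w]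
        · simp
      · rw [system, List.map_flatMap, count_flatMap_finRange, Finset.sum_eq_single i]
        · simp [constraints, hi, LinPoly.varAdd_inj, hci.ne]
        · intro l _ hl
          unfold constraints
          cases D.kind l <;>
            simp [LinPoly.varAdd_inj, hl, LinPoly.lift_ne_varAdd_w]
        · simp
  refine ⟨κ, ?_, h2, h3, ?_⟩
  · refine forall_mem_system.mpr fun i => ⟨fun hi => ?_, fun hi => ?_⟩
    · have hci := hc i (by simp [hi])
      have hv := hvarin (zVar t i) (D.c i) {i | κ i = .z} (by simp [κz, hi])
      exact ⟨⟨.inl ⟨hv, hlift _⟩, hvarnn _ _ hci.le, hliftnn _ (hF i), hci⟩,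
        .inl ⟨hv, hlift _⟩, hvarnn _ _ hci.le, hliftnn _ (hG i), hci⟩
    · have hci := hc i (by simp [hi])
      have hv := fun c => hvarin (wVar t i) c {i | κ i = .w} (by simp [κw, hi])
      have hnc : ∀ c, ¬ (LinPoly.varAdd (wVar t i) c).IsConstant := fun c h => by
        simpa [LinPoly.coeff_varAdd] using h (wVar t i)
      exact ⟨⟨.inr ⟨hlift _, hv _, hnc _⟩, hliftnn _ (hF i), hvarnn _ _ le_rfl, (hw i hi).1⟩,
        .inr ⟨hlift _, hv _, hnc _⟩, hliftnn _ (hG i), hvarnn _ _ hci.le, (hw i hi).2⟩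
  · refine var_cases (fun s h => ?_) (fun i _ j => ?_) (fun i _ j => ?_)
    · simp [κy] at h
    · simp [triple, zVar]
    · simp [triple, wVar]

/-! ### The bit length of the encoding -/

theorem intSize_le {a : ℤ} {Q : ℕ} (h : a.natAbs < 2 ^ Q) : intSize a ≤ Q + 1 := by
  rw [intSize, add_comm]
  exact Nat.succ_le_succ (Nat.clog_le_of_le_pow h)

theorem vecSize_le {n : ℕ} {s : Fin n → ℕ} {B : ℕ} (h : ∀ i, s i ≤ B) :
    vecSize s ≤ n * (B + 1) := by
  have : ∑ i, s i ≤ n * B := by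
    simpa using Finset.sum_le_card_nsmul Finset.univ s B fun i _ => h i
  rw [vecSize]
  linarith

theorem listSize_le {α : Type} {s : α → ℕ} {l : List α} {B : ℕ} (h : ∀ a ∈ l, s a ≤ B) :
    listSize s l ≤ l.length * (B + 1) := by
  have : (l.map s).sum ≤ l.length * B := by
    simpa using List.sum_le_card_nsmul (l.map s) B (by simpa using h)
  rw [listSize]
  linarith

theorem size_linPoly_le {n : ℕ} {p : LinPoly n} {Q : ℕ} (h : ∀ i, (p.coeff i).natAbs < 2 ^ Q)
    (hc : p.const.natAbs < 2 ^ Q) : p.size ≤ (n + 1) * (Q + 2) := by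
  have h1 := vecSize_le fun i => intSize_le (h i)
  have h2 := intSize_le hc
  rw [LinPoly.size]
  linarith

theorem size_triple_le (u : Fin d → ℤ) (E : Matrix (Fin d) (Fin t) ℤ) {Q : ℕ} (hQ : 1 ≤ Q)
    (hc : ∀ i, (D.c i).natAbs < 2 ^ Q)
    (hF : ∀ i, (∀ s, ((D.F i).coeff s).natAbs < 2 ^ Q) ∧ (D.F i).const.natAbs < 2 ^ Q)
    (hG : ∀ i, (∀ s, ((D.G i).coeff s).natAbs < 2 ^ Q) ∧ (D.G i).const.natAbs < 2 ^ Q)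
    (hu : ∀ j, (u j).natAbs < 2 ^ Q) (hE : ∀ j s, (E j s).natAbs < 2 ^ Q) :
    (D.triple u E).size ≤ k * 2 * (2 * ((t + (k + k) + 1) * (Q + 2)) + 1) + d * (Q + 2) +
      (t + (k + k)) * (d * (Q + 2) + 1) := by
  have hpos : 0 < 2 ^ Q := by positivity
  have h1Q : 1 < 2 ^ Q := Nat.one_lt_two_pow (by omega)
  have hlift : ∀ p : LinPoly t, ((∀ s, (p.coeff s).natAbs < 2 ^ Q) ∧ p.const.natAbs < 2 ^ Q) →
      (p.lift k).size ≤ (t + (k + k) + 1) * (Q + 2) := fun p hp =>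
    size_linPoly_le (var_cases (by simpa using hp.1) (by simp) (by simp)) hp.2
  have hvar : ∀ (i : Fin (t + (k + k))) (c : ℤ), c.natAbs < 2 ^ Q →
      (LinPoly.varAdd i c).size ≤ (t + (k + k) + 1) * (Q + 2) := fun i c hc =>
    size_linPoly_le (fun j => by rw [LinPoly.coeff_varAdd]; split_ifs <;> simp; omega) hc
  refine Nat.add_le_add (Nat.add_le_add ?_ ?_) ?_
  · have hlen : D.system.length ≤ k * 2 := by
      rw [system, List.length_flatMap]
      refine (List.sum_le_card_nsmul _ 2 ?_).trans (by simp)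
      intro n hn
      obtain ⟨i, -, rfl⟩ := List.mem_map.mp hn
      unfold constraints
      cases D.kind i <;> simp
    refine (listSize_le (forall_mem_system.mpr fun i => ?_)).trans
      (Nat.mul_le_mul_right _ hlen)
    have h1 := hlift _ (hF i)
    have h2 := hlift _ (hG i)
    have h3 := hvar (zVar t i) _ (hc i)
    have h4 := hvar (wVar t i) _ (hc i)
    have h5 := hvar (wVar t i) 0 (by simp)
    rw [two_mul]
    exact ⟨fun _ => ⟨Nat.add_le_add h3 h1, Nat.add_le_add h3 h2⟩,
      fun _ => ⟨Nat.add_le_add h1 h5, Nat.add_le_add h2 h4⟩⟩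
  · exact vecSize_le fun j => intSize_le (hu j)
  · refine vecSize_le fun i => vecSize_le fun j => intSize_le ?_
    revert i
    refine var_cases (fun s => ?_) (fun i => ?_) (fun i => ?_)
    · simpa [triple, yVar] using hE j s
    · simp [triple, zVar]
    · simp [triple, wVar]

end GcdFamily

end Encoding

/-! ### Independence from a gap between small and large values -/

section Gap

variable {n : ℕ}

namespace LinPoly

theorem IsConstant.eval_eq {p : LinPoly n} (h : p.IsConstant) (x : Fin n → ℤ) :
    p.eval x = p.const := by
  simp [eval, show ∀ i, p.coeff i = 0 from h]

theorem IsConstant.eq_zero {p : LinPoly n} (h : p.IsConstant) (h0 : p.const = 0) : p = 0 :=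
  ext_iff'.mpr ⟨h, h0⟩

theorem IsNonneg.const_le_eval {p : LinPoly n} (hp : p.IsNonneg) {x : Fin n → ℤ}
    (hx : ∀ s, 0 ≤ x s) : p.const ≤ p.eval x :=
  le_add_of_nonneg_left (Finset.sum_nonneg fun i _ => mul_nonneg (hp.1 i) (hx i))

theorem IsNonneg.le_eval {p : LinPoly n} (hp : p.IsNonneg) {x : Fin n → ℤ}
    (hx : ∀ s, 0 ≤ x s) {s : Fin n} (hs : p.coeff s ≠ 0) : x s ≤ p.eval x := by
  have h1 : p.coeff s * x s ≤ ∑ i, p.coeff i * x i :=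
    Finset.single_le_sum (f := fun i => p.coeff i * x i)
      (fun i _ => mul_nonneg (hp.1 i) (hx i)) (Finset.mem_univ s)
  have h2 : x s ≤ p.coeff s * x s :=
    le_mul_of_one_le_left (hx s) (lt_of_le_of_ne (hp.1 s) hs.symm)
  exact h2.trans (h1.trans (le_add_of_nonneg_right hp.2))

/-- Non-negative polynomials with coefficients at most `A` and constant at most `S`. -/
structure Bounded (A S : ℤ) (p : LinPoly n) : Prop where
  nonneg : p.IsNonneg
  coeff_le : ∀ i, p.coeff i ≤ A
  const_le : p.const ≤ S

variable {A S L g : ℤ} {p q : LinPoly n} {y : Fin n → ℤ}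

theorem Bounded.eq_zero_of_isConstant (hA : 1 ≤ A) (hp : p.Bounded A S) (hL : A * S ≤ L)
    (hg : L < g) (hgp : g ∣ p.eval y) (hc : p.IsConstant) : p = 0 := by
  rw [hc.eval_eq] at hgp
  refine hc.eq_zero (Int.eq_zero_of_dvd_of_nonneg_of_lt hp.nonneg.2 ?_ hgp)
  have := hp.const_le
  have := hp.nonneg.2
  nlinarith

/-- If `g` divides the values of `p` and `q` and is large compared to their coefficients, then the
only constant combination of `p` and `q` is zero: up to a factor it is the combination whose
multipliers are coefficients of `p` and `q`, which has a small multiple of `g` as its value. -/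
theorem Bounded.combination_eq_zero (hA : 1 ≤ A) (hp : p.Bounded A S) (hq : q.Bounded A S)
    (hL : A * S ≤ L) (hg : L < g) (hgp : g ∣ p.eval y) (hgq : g ∣ q.eval y) {α β : ℤ}
    (hc : (α • p + β • q).IsConstant) : α • p + β • q = 0 := by
  by_cases hcc : p.IsConstant ∧ q.IsConstant
  · rw [hp.eq_zero_of_isConstant hA hL hg hgp hcc.1, hq.eq_zero_of_isConstant hA hL hg hgq hcc.2]
    simp only [smul_zero, add_zero]
  · obtain ⟨s, hs⟩ : ∃ s, ¬ (p.coeff s = 0 ∧ q.coeff s = 0) := by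
      by_contra! h
      exact hcc ⟨fun s => (h s).1, fun s => (h s).2⟩
    set a := p.coeff s with ha
    set b := q.coeff s with hb
    have hαβ : α * a + β * b = 0 := by simpa only [coeff_add, coeff_smul] using hc s
    set r := b • p + (-a) • q with hr
    have h1 : b • (α • p + β • q) = α • r := by
      have : b * β = α * (-a) := by linarith
      simp only [hr, smul_add, smul_smul, this, mul_comm b α]
    have h2 : a • (α • p + β • q) = (-β) • r := by
      have : a * α = -β * b := by linarith
      simp only [hr, smul_add, smul_smul, this]
      ring_nf
    by_cases hr0 : r = 0
    · rw [hr0, smul_zero] at h1 h2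
      rcases not_and_or.mp hs with h | h
      · exact (smul_eq_zero.mp h2).resolve_left h
      · exact (smul_eq_zero.mp h1).resolve_left h
    · by_cases hα : α = 0 ∧ β = 0
      · simp only [hα.1, hα.2, zero_smul, add_zero]
      · exfalso
        have hrc : r.IsConstant := fun i => by
          have e1 := congrArg (fun p : LinPoly n => p.coeff i) h1
          have e2 := congrArg (fun p : LinPoly n => p.coeff i) h2
          simp only [coeff_smul] at e1 e2
          rw [hc i, mul_zero] at e1 e2
          rcases not_and_or.mp hα with h | h
          · exact (mul_eq_zero.mp e1.symm).resolve_left h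
          · exact (mul_eq_zero.mp e2.symm).resolve_left (neg_ne_zero.mpr h)
        have hdvd : g ∣ r.const := by
          rw [← hrc.eval_eq y, hr, eval_add, eval_smul, eval_smul]
          exact dvd_add (Dvd.dvd.mul_left hgp _) (Dvd.dvd.mul_left hgq _)
        have hb0 := hq.nonneg.1 s
        have ha0 := hp.nonneg.1 s
        have hb1 := mul_le_mul (hq.coeff_le s) hp.const_le hp.nonneg.2 (by linarith)
        have ha1 := mul_le_mul (hp.coeff_le s) hq.const_le hq.nonneg.2 (by linarith)
        have hb2 := mul_nonneg hb0 hp.nonneg.2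
        have ha2 := mul_nonneg ha0 hq.nonneg.2
        have hrconst : r.const = b * p.const - a * q.const := by
          rw [hr, const_add, const_smul, const_smul]; ring
        refine hr0 (hrc.eq_zero (Int.eq_zero_of_abs_lt_dvd hdvd ?_))
        rw [hrconst, abs_lt]
        constructor <;> linarith

/-- If `g` divides the values of `p` and `q` and is large compared to their coefficients, then
`g` divides a small multiple of the value of each polynomial in the rational span of `p` and `q`:
the multiplier is a non-zero minor of the coefficients, as in Cramer's rule. -/
theorem Bounded.exists_dvd_mul_eval (hA : 1 ≤ A) (hp : p.Bounded A S) (hq : q.Bounded A S)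
    (hL : A * S ≤ L) (hg : L < g) (hgp : g ∣ p.eval y) (hgq : g ∣ q.eval y) :
    ∃ m : ℤ, m ≠ 0 ∧ |m| ≤ A ^ 2 ∧ ∀ (v : LinPoly n) (b α β : ℤ), b ≠ 0 →
      b • v = α • p + β • q → g ∣ m * v.eval y := by
  have hcomb : ∀ α β : ℤ, g ∣ (α • p + β • q).eval y := fun α β => by
    rw [eval_add, eval_smul, eval_smul]
    exact dvd_add (Dvd.dvd.mul_left hgp _) (Dvd.dvd.mul_left hgq _)
  have hcoeff : ∀ {v : LinPoly n} {b α β : ℤ}, b • v = α • p + β • q → ∀ s,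
      b * v.coeff s = α * p.coeff s + β * q.coeff s := fun h s => by
    simpa only [coeff_add, coeff_smul] using congrArg (fun p : LinPoly n => p.coeff s) h
  -- it suffices to write `m • v` as an integer combination
  have hsuff : ∀ {m b : ℤ} {v : LinPoly n} (α' β' : ℤ), b ≠ 0 →
      b • (m • v) = b • (α' • p + β' • q) → g ∣ m * v.eval y := by
    intro m b v α' β' hb h
    rw [← eval_smul, smul_right_injective _ hb h]
    exact hcomb α' β'
  have hAA : A ≤ A ^ 2 := by nlinarith
  by_cases hminor : ∃ s t, p.coeff s * q.coeff t - p.coeff t * q.coeff s ≠ 0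
  · obtain ⟨s, t, hm⟩ := hminor
    refine ⟨_, hm, ?_, fun v b α β hb h => ?_⟩
    · have h1 := mul_le_mul (hp.coeff_le s) (hq.coeff_le t) (hq.nonneg.1 t) (by linarith)
      have h2 := mul_le_mul (hp.coeff_le t) (hq.coeff_le s) (hq.nonneg.1 s) (by linarith)
      have h3 := mul_nonneg (hp.nonneg.1 s) (hq.nonneg.1 t)
      have h4 := mul_nonneg (hp.nonneg.1 t) (hq.nonneg.1 s)
      rw [abs_le]
      constructor <;> nlinarith
    · refine hsuff (v.coeff s * q.coeff t - v.coeff t * q.coeff s)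
        (p.coeff s * v.coeff t - p.coeff t * v.coeff s) hb ?_
      have hs := hcoeff h s
      have ht := hcoeff h t
      rw [smul_comm b, h]
      have e1 : b * (v.coeff s * q.coeff t - v.coeff t * q.coeff s) =
          (p.coeff s * q.coeff t - p.coeff t * q.coeff s) * α := by
        linear_combination q.coeff t * hs - q.coeff s * ht
      have e2 : b * (p.coeff s * v.coeff t - p.coeff t * v.coeff s) =
          (p.coeff s * q.coeff t - p.coeff t * q.coeff s) * β := by
        linear_combination p.coeff s * ht - p.coeff t * hs
      simp only [smul_add, smul_smul, e1, e2]
  push Not at hminor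
  by_cases hps : ∃ s, p.coeff s ≠ 0
  · obtain ⟨s, hs0⟩ := hps
    refine ⟨p.coeff s, hs0, ?_, fun v b α β hb h => ?_⟩
    · rw [abs_of_nonneg (hp.nonneg.1 s)]
      exact (hp.coeff_le s).trans hAA
    · have hdep : (-q.coeff s) • p + p.coeff s • q = 0 :=
        hp.combination_eq_zero hA hq hL hg hgp hgq fun t => by
          rw [coeff_add, coeff_smul, coeff_smul]
          linear_combination hminor s t
      have hdep' : p.coeff s • q = q.coeff s • p := by
        rw [neg_smul, neg_add_eq_zero] at hdep
        exact hdep.symm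
      refine hsuff (v.coeff s) 0 hb ?_
      rw [smul_comm b, h, smul_add, smul_comm _ β, hdep', zero_smul, add_zero]
      simp only [smul_smul, ← add_smul, hcoeff h s]
      ring_nf
  push Not at hps
  by_cases hqs : ∃ s, q.coeff s ≠ 0
  · obtain ⟨s, hs0⟩ := hqs
    have hp0 : p = 0 := hp.eq_zero_of_isConstant hA hL hg hgp hps
    refine ⟨q.coeff s, hs0, ?_, fun v b α β hb h => ?_⟩
    · rw [abs_of_nonneg (hq.nonneg.1 s)]
      exact (hq.coeff_le s).trans hAA
    · refine hsuff 0 (v.coeff s) hb ?_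
      rw [smul_comm b, h]
      simp only [hp0, smul_zero, zero_add, smul_smul, hcoeff h s, coeff_zero, mul_zero]
      ring_nf
  · push Not at hqs
    refine ⟨1, one_ne_zero, by rw [abs_one]; nlinarith, fun v b α β hb h => ?_⟩
    rw [hp.eq_zero_of_isConstant hA hL hg hgp hps, hq.eq_zero_of_isConstant hA hL hg hgq hqs] at h
    simp only [smul_zero, add_zero] at h
    rw [(smul_eq_zero.mp h).resolve_left hb]
    simp [eval, coeff, const]

end LinPoly

namespace GcdFamily

variable {k : ℕ} {D : GcdFamily n k} {A S B L : ℤ} {y : Fin n → ℤ}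

/-- A family of conditions is independent if at some point all variables that occur and all
greatest common divisors of the kind `z` are larger than `L`, while the greatest common divisors
of the kind `w` are at most `B`, where `L` is much larger than `B` and the coefficients. -/
theorem independent_of_gap (hA : 1 ≤ A) (hL : A * S ≤ L) (hL' : A ^ 2 * B ≤ L)
    (hF : ∀ i, (D.F i).Bounded A S) (hG : ∀ i, (D.G i).Bounded A S) (hy : ∀ s, 0 ≤ y s)
    (hyF : ∀ i s, (D.F i).coeff s ≠ 0 → L < y s)
    (hz : ∀ i, D.kind i = .z → L < Int.gcd ((D.F i).eval y) ((D.G i).eval y))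
    (hw : ∀ i, D.kind i = .w → (0 < (D.F i).const ∧ 0 < (D.G i).const) ∧
      (Int.gcd ((D.F i).eval y) ((D.G i).eval y) : ℤ) ≤ B) : D.Independent where
  ne_zero j hj := by
    obtain ⟨⟨h1, h2⟩, -⟩ := hw j hj
    constructor <;> intro h
    · rw [h] at h1; exact lt_irrefl _ h1
    · rw [h] at h2; exact lt_irrefl _ h2
  eq_zero_of_isConstant i hi α β hc :=
    (hF i).combination_eq_zero hA (hG i) hL (hz i hi) (Int.gcd_dvd_left _ _)
      (Int.gcd_dvd_right _ _) hc
  isConstant_of_smul_eq j hj p q hp hq h s := by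
    by_contra hs
    obtain ⟨⟨hF0, hG0⟩, hgB⟩ := hw j hj
    set a := (D.F j).coeff s with ha
    set b := (D.G j).coeff s with hb
    have hab : p * a = q * b := by
      simpa only [LinPoly.coeff_smul] using congrArg (fun p : LinPoly n => p.coeff s) h
    have hval : p * (D.F j).eval y = q * (D.G j).eval y := by
      simpa only [LinPoly.eval_smul] using congrArg (fun p : LinPoly n => p.eval y) h
    set f := (D.F j).eval y with hf
    set g := (D.G j).eval y with hg
    have hfg : a * g = b * f := by
      apply mul_left_cancel₀ hp
      apply mul_left_cancel₀ hq
      linear_combination g * q * hab - b * q * hval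
    -- the value of `F` divides `a` times the greatest common divisor
    have hdvd : f ∣ a * Int.gcd f g := by
      have : f ∣ (Int.gcd (a * f) (a * g) : ℤ) :=
        Int.dvd_coe_gcd (dvd_mul_left _ _) (hfg ▸ dvd_mul_left _ _)
      rw [Int.gcd_mul_left] at this
      push_cast at this
      rwa [abs_of_nonneg ((hF j).nonneg.1 s)] at this
    have ha0 : 0 < a := lt_of_le_of_ne ((hF j).nonneg.1 s) (Ne.symm hs)
    have hf0 : 0 < f := lt_of_lt_of_le hF0 ((hF j).nonneg.const_le_eval hy)
    have hgpos : (0 : ℤ) < Int.gcd f g := by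
      exact_mod_cast Int.gcd_pos_of_ne_zero_left _ hf0.ne'
    have h1 := Int.le_of_dvd (mul_pos ha0 hgpos) hdvd
    have h2 := (hF j).nonneg.le_eval hy hs
    have h3 := hyF j s hs
    have h4 := mul_le_mul ((hF j).coeff_le s) hgB hgpos.le (by linarith)
    have h5 : A * B ≤ A ^ 2 * B := by nlinarith
    linarith
  not_span i j hi hj := by
    rintro ⟨⟨b, α, β, hb, h⟩, b', α', β', hb', h'⟩
    obtain ⟨⟨hF0, hG0⟩, hgB⟩ := hw j hj
    obtain ⟨m, hm0, hmA, hm⟩ := (hF i).exists_dvd_mul_eval hA (hG i) hL (hz i hi)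
      (Int.gcd_dvd_left _ _) (Int.gcd_dvd_right _ _)
    have h1 := Int.dvd_coe_gcd (hm _ b α β hb h) (hm _ b' α' β' hb' h')
    rw [Int.gcd_mul_left] at h1
    push_cast at h1
    have hgpos : (0 : ℤ) < Int.gcd ((D.F j).eval y) ((D.G j).eval y) := by
      have := lt_of_lt_of_le hF0 ((hF j).nonneg.const_le_eval hy)
      exact_mod_cast Int.gcd_pos_of_ne_zero_left _ this.ne'
    have h2 := Int.le_of_dvd (mul_pos (abs_pos.mpr hm0) hgpos) h1
    have h3 := mul_le_mul hmA hgB hgpos.le (by positivity)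
    linarith [hz i hi]

/-- The conditions on the polynomials `Fᵢ(r + N y)` and `Gᵢ(r + N y)`. -/
def dilate (D : GcdFamily n k) (N : ℤ) (r : Fin n → ℤ) : GcdFamily n k where
  F i := (D.F i).dilate N r
  G i := (D.G i).dilate N r
  kind := D.kind
  c := D.c

theorem Independent.dilate (hD : D.Independent) {N : ℤ} (hN : N ≠ 0) (r : Fin n → ℤ) :
    (D.dilate N r).Independent := by
  have hinj := LinPoly.dilate_injective (n := n) hN r
  have h0 : (0 : LinPoly n).dilate N r = 0 := by
    simpa using LinPoly.dilate_smul N r 0 (0 : LinPoly n)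
  have hcomb : ∀ i (α β : ℤ), α • (D.dilate N r).F i + β • (D.dilate N r).G i =
      (α • D.F i + β • D.G i).dilate N r := fun i α β => by
    rw [LinPoly.dilate_add, LinPoly.dilate_smul, LinPoly.dilate_smul]; rfl
  refine ⟨fun j hj => ⟨fun h => (hD.ne_zero j hj).1 (hinj (h.trans h0.symm)),
    fun h => (hD.ne_zero j hj).2 (hinj (h.trans h0.symm))⟩, fun i hi α β h => ?_,
    fun j hj p q hp hq h => ?_, fun i j hi hj => ?_⟩
  · rw [hcomb] at h ⊢
    rw [hD.eq_zero_of_isConstant i hi α β ((LinPoly.isConstant_dilate hN).mp h), h0]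
  · refine (LinPoly.isConstant_dilate hN).mpr (hD.isConstant_of_smul_eq j hj p q hp hq (hinj ?_))
    rw [LinPoly.dilate_smul, LinPoly.dilate_smul]
    exact h
  · rintro ⟨⟨b, α, β, hb, h⟩, b', α', β', hb', h'⟩
    rw [hcomb] at h h'
    refine hD.not_span i j hi hj ⟨⟨b, α, β, hb, hinj ?_⟩, b', α', β', hb', hinj ?_⟩
    · rw [LinPoly.dilate_smul]; exact h
    · rw [LinPoly.dilate_smul]; exact h'

end GcdFamily

end Gap

/-! ### Decompositions with a gap between small and large coordinates -/

/-- Among the powers of `K ≥ 2` with exponent at most the number of given values, one has no value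
between itself and the next power. -/
theorem exists_gap {κ : Type} [Fintype κ] (v : κ → ℕ) {K : ℕ} (hK : 2 ≤ K) :
    ∃ j ≤ Fintype.card κ, ∀ i, v i ≤ K ^ j ∨ K ^ (j + 1) < v i := by
  by_contra! h
  have h' : ∀ j : Fin (Fintype.card κ + 1), ∃ i, K ^ (j : ℕ) < v i ∧ v i ≤ K ^ (j + 1 : ℕ) :=
    fun j => h j (by omega)
  choose i hi using h'
  obtain ⟨a, b, hne, hab⟩ := Fintype.exists_ne_map_eq_of_card_lt i (by simp)
  wlog hlt : a < b generalizing a b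
  · exact this b a hne.symm hab.symm (lt_of_le_of_ne (not_lt.mp hlt) hne.symm)
  have h1 : K ^ (a + 1 : ℕ) ≤ K ^ (b : ℕ) := Nat.pow_le_pow_right (by omega) hlt
  have h2 := (hi a).2
  have h3 := (hi b).1
  rw [← hab] at h3
  omega

/-- A decomposition of a point of a polyhedron in which all coordinates along the generators that
are used are large, and where the given values `v` are either small or large. The generators with
small coordinates are moved into the base point. -/
theorem exists_gap_decomposition {d : ℕ} {ρ κ : Type} [Fintype ρ] [Fintype κ]
    (p : ρ → LinPoly d) (H : ℕ) (hH1 : 1 ≤ H) (hcoeff : ∀ i j, ((p i).coeff j).natAbs ≤ H)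
    (hconst : ∀ i, (p i).const.natAbs ≤ H) (x : Fin d → ℤ) (hx : ∀ i, 0 ≤ (p i).eval x)
    (v : κ → ℕ) {K : ℕ} (hK : 2 ≤ K)
    (n D : ℕ) (hn : n = 2 * d + Fintype.card ρ + 1) (hD : D = (n * H) ^ n) :
    ∃ t ≤ n, ∃ j ≤ n + Fintype.card κ,
      ∃ (u : Fin d → ℤ) (E : Matrix (Fin d) (Fin t) ℤ) (lam : Fin t → ℕ),
      x = u + E.mulVec (fun k => (lam k : ℤ)) ∧ (∀ i, 0 ≤ (p i).eval u) ∧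
      (∀ i k, 0 ≤ ∑ j, (p i).coeff j * E j k) ∧
      (∀ k, (∀ j, E j k = 0) ∨ K ^ (j + 1) < lam k) ∧ (∀ i, v i ≤ K ^ j ∨ K ^ (j + 1) < v i) ∧
      (∀ l, (u l).natAbs ≤ n * D + n * (D * K ^ j)) ∧ ∀ l k, (E l k).natAbs ≤ D := by
  classical
  obtain ⟨t, ht, u, E, lam, hxu, hu, hE, hub, hEb⟩ :=
    exists_polyhedron_decomposition p H hH1 hcoeff hconst x hx n D hn hD
  obtain ⟨j, hj, hgap⟩ := exists_gap (Sum.elim lam v) hK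
  rw [Fintype.card_sum, Fintype.card_fin] at hj
  let r : Fin t → ℤ := fun k => if lam k ≤ K ^ j then lam k else 0
  let E' : Matrix (Fin d) (Fin t) ℤ := fun l k => if lam k ≤ K ^ j then 0 else E l k
  have hr0 : ∀ k, 0 ≤ r k := fun k => by simp only [r]; split_ifs <;> simp
  have hrb : ∀ k, (r k).natAbs ≤ K ^ j := fun k => by
    simp only [r]
    split_ifs with h
    · simpa using h
    · simp
  refine ⟨t, ht, j, by omega, u + E.mulVec r, E', lam, ?_, fun i => ?_, fun i k => ?_,
    fun k => ?_, fun i => hgap (.inr i), fun l => ?_, fun l k => ?_⟩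
  · rw [hxu, add_assoc]
    congr 1
    funext l
    simp only [Matrix.mulVec, dotProduct, Pi.add_apply, ← Finset.sum_add_distrib]
    refine Finset.sum_congr rfl fun k _ => ?_
    by_cases h : lam k ≤ K ^ j <;> simp [r, E', h]
  · rw [← LinPoly.eval_comp]
    refine (LinPoly.IsNonneg.const_le_eval (p := (p i).comp u E) ⟨hE i, hu i⟩ hr0).trans' (hu i)
  · by_cases h : lam k ≤ K ^ j
    · simp [E', h]
    · simpa [E', h] using hE i k
  · rcases hgap (.inl k) with h | h
    · exact .inl fun l => by simp [E', show lam k ≤ K ^ j from h]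
    · exact .inr h
  · refine (Int.natAbs_add_le _ _).trans (Nat.add_le_add (hub l) ?_)
    refine (Int.natAbs_sum_le Finset.univ fun k => E l k * r k).trans
      ((Finset.sum_le_card_nsmul _ _ (D * K ^ j) fun k _ => ?_).trans ?_)
    · rw [Int.natAbs_mul]
      exact Nat.mul_le_mul (hEb l k) (hrb k)
    · simpa using Nat.mul_le_mul_right _ ht
  · by_cases h : lam k ≤ K ^ j
    · simp [E', h]
    · simpa [E', h] using hEb l k

namespace LinPoly

variable {d t : ℕ}

/-- Two polynomials (for the two values of `b`) whose non-negativity expresses that `p` has the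
same sign as `v`. -/
def signRow (p : LinPoly d) (v : ℤ) (b : Bool) : LinPoly d :=
  if 0 < v then (p.1, p.2 - 1) else if v < 0 then (-p.1, -p.2 - 1) else if b then p else -p

theorem eval_signRow (p : LinPoly d) (v : ℤ) (b : Bool) (x : Fin d → ℤ) :
    (p.signRow v b).eval x = if 0 < v then p.eval x - 1 else if v < 0 then -p.eval x - 1
      else if b then p.eval x else -p.eval x := by
  unfold signRow
  split_ifs
  · simp only [eval, coeff, const]; ring
  · simp only [eval, coeff, const, Pi.neg_apply, neg_mul, Finset.sum_neg_distrib]; ring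
  · rfl
  · simp only [eval, coeff, const, Prod.fst_neg, Prod.snd_neg, Pi.neg_apply, neg_mul,
      Finset.sum_neg_distrib]; ring

theorem coeff_signRow (p : LinPoly d) (v : ℤ) (b : Bool) (i : Fin d) :
    (p.signRow v b).coeff i = if 0 < v then p.coeff i else if v < 0 then -p.coeff i
      else if b then p.coeff i else -p.coeff i := by
  unfold signRow
  split_ifs <;> rfl

theorem natAbs_coeff_signRow (p : LinPoly d) (v : ℤ) (b : Bool) (i : Fin d) :
    ((p.signRow v b).coeff i).natAbs = (p.coeff i).natAbs := by
  rw [coeff_signRow]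
  split_ifs <;> simp

theorem natAbs_const_signRow_le (p : LinPoly d) (v : ℤ) (b : Bool) :
    (p.signRow v b).const.natAbs ≤ p.const.natAbs + 1 := by
  unfold signRow
  split_ifs <;> simp only [const, Prod.snd_neg] <;> omega

theorem eval_signRow_self_nonneg (p : LinPoly d) (x : Fin d → ℤ) (b : Bool) :
    0 ≤ (p.signRow (p.eval x) b).eval x := by
  rw [eval_signRow]
  split_ifs <;> omega

/-- The polynomial `p(u + E y)`, multiplied by the sign of `v`. -/
def signComp (p : LinPoly d) (v : ℤ) (u : Fin d → ℤ) (E : Matrix (Fin d) (Fin t) ℤ) :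
    LinPoly t := v.sign • p.comp u E

variable {p : LinPoly d} {v : ℤ} {u : Fin d → ℤ} {E : Matrix (Fin d) (Fin t) ℤ}

theorem comp_eq_zero (hu : ∀ b, 0 ≤ (p.signRow v b).eval u)
    (hE : ∀ b k, 0 ≤ ∑ j, (p.signRow v b).coeff j * E j k) (hv : v = 0) : p.comp u E = 0 := by
  subst hv
  rw [ext_iff']
  refine ⟨fun k => ?_, ?_⟩
  · have h1 := hE true k
    have h2 := hE false k
    simp only [coeff_signRow, lt_irrefl, if_false, if_true, Bool.false_eq_true, neg_mul,
      Finset.sum_neg_distrib] at h1 h2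
    rw [coeff_comp, coeff_zero]
    omega
  · have h1 := hu true
    have h2 := hu false
    simp only [eval_signRow, lt_irrefl, if_false, if_true, Bool.false_eq_true] at h1 h2
    rw [const_comp, const_zero]
    omega

theorem signComp_nonneg (hu : ∀ b, 0 ≤ (p.signRow v b).eval u)
    (hE : ∀ b k, 0 ≤ ∑ j, (p.signRow v b).coeff j * E j k) :
    (p.signComp v u E).IsNonneg ∧ (v ≠ 0 → 0 < (p.signComp v u E).const) := by
  have hu' := hu true
  have hE' := hE true
  rcases lt_trichotomy v 0 with h | h | h
  · simp only [eval_signRow, coeff_signRow, h, h.not_gt, if_true, if_false, neg_mul,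
      Finset.sum_neg_distrib] at hu' hE'
    have hc : (p.signComp v u E).const = -p.eval u := by
      rw [signComp, const_smul, const_comp, Int.sign_eq_neg_one_of_neg h]; ring
    refine ⟨⟨fun k => ?_, by omega⟩, fun _ => by omega⟩
    rw [signComp, coeff_smul, coeff_comp, Int.sign_eq_neg_one_of_neg h]
    linarith [hE' k]
  · rw [signComp, comp_eq_zero hu hE h, smul_zero]
    exact ⟨⟨fun _ => le_rfl, le_rfl⟩, fun hv => absurd h hv⟩
  · simp only [eval_signRow, coeff_signRow, h, if_true] at hu' hE'
    have hc : (p.signComp v u E).const = p.eval u := by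
      rw [signComp, const_smul, const_comp, Int.sign_eq_one_of_pos h]; ring
    refine ⟨⟨fun k => ?_, by omega⟩, fun _ => by omega⟩
    rw [signComp, coeff_smul, coeff_comp, Int.sign_eq_one_of_pos h]
    linarith [hE' k]

/-- Up to the sign, `signComp` computes the values of `p`: where the sign is zero, so is `p`. -/
theorem natAbs_eval_signComp (hu : ∀ b, 0 ≤ (p.signRow v b).eval u)
    (hE : ∀ b k, 0 ≤ ∑ j, (p.signRow v b).coeff j * E j k) (y : Fin t → ℤ) :
    ((p.signComp v u E).eval y).natAbs = (p.eval (u + E.mulVec y)).natAbs := by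
  rw [← eval_comp]
  rcases eq_or_ne v 0 with h | h
  · rw [signComp, comp_eq_zero hu hE h, smul_zero]
  · rw [signComp, eval_smul, Int.natAbs_mul, Int.natAbs_sign_of_ne_zero h, one_mul]

end LinPoly

/-! ### The encoding at a point -/

section Point

variable {d k t : ℕ}

/-- The greatest common divisors at the point `x`. -/
def gcdAt (f g : Fin k → LinPoly d) (x : Fin d → ℤ) (i : Fin k) : ℕ :=
  Int.gcd ((f i).eval x) ((g i).eval x)

/-- The conditions that preserve the small greatest common divisors at the point `x`, and keep
those that exceed `L` above `c`. Greatest common divisors of which one side vanishes are either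
constant on the set `u + E y` or large. -/
def gapFamily (f g : Fin k → LinPoly d) (c : Fin k → ℕ) (x u : Fin d → ℤ)
    (E : Matrix (Fin d) (Fin t) ℤ) (L : ℕ) : GcdFamily t k where
  F i := (f i).signComp ((f i).eval x) u E
  G i := (g i).signComp ((g i).eval x) u E
  kind i := if L < gcdAt f g x i then .z
    else if (f i).eval x ≠ 0 ∧ (g i).eval x ≠ 0 then .w else .y
  c i := if L < gcdAt f g x i then c i + 1 else gcdAt f g x i

/-- The product of the small non-zero greatest common divisors at the point `x`. -/
def modulus (f g : Fin k → LinPoly d) (x : Fin d → ℤ) (L : ℕ) : ℕ :=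
  ∏ i, if L < gcdAt f g x i ∨ gcdAt f g x i = 0 then 1 else gcdAt f g x i

/-- The point `x = u + E lam` is written with the base point `u` and generators `E` such that the
`fᵢ` and `gᵢ` do not change sign on `u + E y`, `y ≥ 0`, and no relevant value at `x` lies between
`B` and `L`. -/
structure IsGapPoint (f g : Fin k → LinPoly d) (c : Fin k → ℕ) (x u : Fin d → ℤ)
    (E : Matrix (Fin d) (Fin t) ℤ) (lam : Fin t → ℕ) (B L : ℕ) : Prop where
  eq : x = u + E.mulVec (fun s => (lam s : ℤ))
  f_base : ∀ i b, 0 ≤ ((f i).signRow ((f i).eval x) b).eval u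
  f_dir : ∀ i b s, 0 ≤ ∑ j, ((f i).signRow ((f i).eval x) b).coeff j * E j s
  g_base : ∀ i b, 0 ≤ ((g i).signRow ((g i).eval x) b).eval u
  g_dir : ∀ i b s, 0 ≤ ∑ j, ((g i).signRow ((g i).eval x) b).coeff j * E j s
  large : ∀ s, (∀ j, E j s = 0) ∨ L < lam s
  gap : ∀ i, gcdAt f g x i ≤ B ∨ L < gcdAt f g x i
  c_lt : ∀ i, c i < L

theorem modulus_pos (f g : Fin k → LinPoly d) (x : Fin d → ℤ) (L : ℕ) : 0 < modulus f g x L := by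
  refine Finset.prod_pos fun i _ => ?_
  split_ifs with h
  · exact one_pos
  · omega

theorem gcdAt_dvd_modulus {f g : Fin k → LinPoly d} {x : Fin d → ℤ} {L : ℕ} {i : Fin k}
    (h : ¬ L < gcdAt f g x i) (h0 : gcdAt f g x i ≠ 0) : gcdAt f g x i ∣ modulus f g x L := by
  have h1 := Finset.dvd_prod_of_mem
    (fun i => if L < gcdAt f g x i ∨ gcdAt f g x i = 0 then 1 else gcdAt f g x i)
    (Finset.mem_univ i)
  rw [if_neg (not_or.mpr ⟨h, h0⟩)] at h1
  exact h1

namespace IsGapPoint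

variable {f g : Fin k → LinPoly d} {c : Fin k → ℕ} {x u : Fin d → ℤ}
  {E : Matrix (Fin d) (Fin t) ℤ} {lam : Fin t → ℕ} {B L : ℕ}

theorem modulus_le (h : IsGapPoint f g c x u E lam B L) (hB : 1 ≤ B) :
    modulus f g x L ≤ B ^ k := by
  refine (Finset.prod_le_pow_card _ _ B fun i _ => ?_).trans (by simp)
  have := h.gap i
  split_ifs with h'
  · exact hB
  · omega

theorem gcd_eval (h : IsGapPoint f g c x u E lam B L) (i : Fin k) (y : Fin t → ℤ) :
    Int.gcd (((gapFamily f g c x u E L).F i).eval y) (((gapFamily f g c x u E L).G i).eval y) =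
      gcdAt f g (u + E.mulVec y) i := by
  rw [gcdAt, Int.gcd_def, Int.gcd_def]
  exact congrArg₂ _ (LinPoly.natAbs_eval_signComp (h.f_base i) (h.f_dir i) y)
    (LinPoly.natAbs_eval_signComp (h.g_base i) (h.g_dir i) y)

theorem gcd_eval_self (h : IsGapPoint f g c x u E lam B L) (i : Fin k) :
    Int.gcd (((gapFamily f g c x u E L).F i).eval fun s => (lam s : ℤ))
      (((gapFamily f g c x u E L).G i).eval fun s => (lam s : ℤ)) = gcdAt f g x i := by
  rw [h.gcd_eval, ← h.eq]

theorem F_nonneg (h : IsGapPoint f g c x u E lam B L) (i : Fin k) :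
    ((gapFamily f g c x u E L).F i).IsNonneg ∧
      ((f i).eval x ≠ 0 → 0 < ((gapFamily f g c x u E L).F i).const) :=
  LinPoly.signComp_nonneg (h.f_base i) (h.f_dir i)

theorem G_nonneg (h : IsGapPoint f g c x u E lam B L) (i : Fin k) :
    ((gapFamily f g c x u E L).G i).IsNonneg ∧
      ((g i).eval x ≠ 0 → 0 < ((gapFamily f g c x u E L).G i).const) :=
  LinPoly.signComp_nonneg (h.g_base i) (h.g_dir i)

theorem F_eq_zero (h : IsGapPoint f g c x u E lam B L) {i : Fin k} (hi : (f i).eval x = 0) :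
    (gapFamily f g c x u E L).F i = 0 := by
  have := LinPoly.comp_eq_zero (h.f_base i) (h.f_dir i) hi
  simp only [gapFamily, LinPoly.signComp, this, smul_zero]

theorem G_eq_zero (h : IsGapPoint f g c x u E lam B L) {i : Fin k} (hi : (g i).eval x = 0) :
    (gapFamily f g c x u E L).G i = 0 := by
  have := LinPoly.comp_eq_zero (h.g_base i) (h.g_dir i) hi
  simp only [gapFamily, LinPoly.signComp, this, smul_zero]

/-- The variables that occur are large at the point. -/
theorem lt_of_coeff_ne_zero (h : IsGapPoint f g c x u E lam B L) {p : LinPoly d} {v : ℤ}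
    {s : Fin t} (hs : (p.signComp v u E).coeff s ≠ 0) : L < lam s := by
  refine (h.large s).resolve_left fun h0 => hs ?_
  rw [LinPoly.signComp, LinPoly.coeff_smul, LinPoly.coeff_comp]
  simp [h0]

theorem isConstant_of_eval_le (h : IsGapPoint f g c x u E lam B L) {p : LinPoly d} {v : ℤ}
    (hp : (p.signComp v u E).IsNonneg)
    (hle : (p.signComp v u E).eval (fun s => (lam s : ℤ)) ≤ L) :
    (p.signComp v u E).IsConstant := by
  intro s
  by_contra hs
  have h1 := h.lt_of_coeff_ne_zero hs
  have h2 := hp.le_eval (x := fun s => (lam s : ℤ)) (fun s => Int.natCast_nonneg _) hs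
  omega

theorem ne_zero_of_kind_z (h : IsGapPoint f g c x u E lam B L) {i : Fin k}
    (hi : L < gcdAt f g x i) {y : Fin t → ℤ} (hy : ∀ s, 0 ≤ y s) :
    gcdAt f g (u + E.mulVec y) i ≠ 0 := by
  intro h0
  rw [← h.gcd_eval, Int.gcd_eq_zero_iff] at h0
  have h1 := (h.F_nonneg i).1.const_le_eval hy
  have h2 := (h.G_nonneg i).1.const_le_eval hy
  have h3 : (f i).eval x = 0 := by
    by_contra h'
    have := (h.F_nonneg i).2 h'
    omega
  have h4 : (g i).eval x = 0 := by
    by_contra h'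
    have := (h.G_nonneg i).2 h'
    omega
  simp [gcdAt, h3, h4] at hi

/-- Solutions of the encoding, after restriction to a residue class of the modulus, keep the small
greatest common divisors and keep the large ones above `c`. -/
theorem gcdAt_of_isSolution (h : IsGapPoint f g c x u E lam B L)
    {N : ℕ} (hN : N = modulus f g x L) {r : Fin t → ℤ} (hr : ∀ s, 0 ≤ r s) (hrm : ∀ s, (N : ℤ) ∣ lam s - r s)
    {z : Fin (t + (k + k)) → ℤ} (hz : ∀ s, 0 ≤ z s)
    (hsol : ((gapFamily f g c x u E L).dilate N r).system.IsSolution z)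
    (i : Fin k) {y : Fin t → ℤ}
    (hy : y = r + (N : ℤ) • fun s => z (yVar k s)) :
    gcdAt f g (u + E.mulVec y) i = gcdAt f g x i ∨
      (L < gcdAt f g x i ∧ c i < gcdAt f g (u + E.mulVec y) i) := by
  subst hN
  have hy0 : ∀ s, 0 ≤ y s := fun s => by
    rw [hy]
    exact add_nonneg (hr s) (mul_nonneg (Int.natCast_nonneg _) (hz _))
  have hsol' := GcdFamily.isSolution_system_iff.mp hsol i
  simp only [GcdFamily.dilate, LinPoly.eval_dilate, ← hy] at hsol'
  by_cases hi : L < gcdAt f g x i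
  · refine .inr ⟨hi, ?_⟩
    obtain ⟨-, h1, h2⟩ := hsol'.1 (by simp [gapFamily, hi])
    have h3 := Int.dvd_coe_gcd h1 h2
    rw [h.gcd_eval] at h3
    have h4 := Int.le_of_dvd
      (by exact_mod_cast Nat.pos_of_ne_zero (h.ne_zero_of_kind_z hi hy0)) h3
    have h5 : (gapFamily f g c x u E L).c i = c i + 1 := by simp [gapFamily, hi]
    have := hz (zVar t i)
    omega
  refine .inl ?_
  by_cases hfg : (f i).eval x ≠ 0 ∧ (g i).eval x ≠ 0
  · have hk : (gapFamily f g c x u E L).kind i = .w := by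
      simp only [gapFamily, hi, if_false]
      exact if_pos hfg
    have hc : (gapFamily f g c x u E L).c i = gcdAt f g x i := by simp [gapFamily, hi]
    obtain ⟨-, h1, h2⟩ := hsol'.2 hk
    rw [hc] at h2
    have hv0 : gcdAt f g x i ≠ 0 := fun h0 => hfg.1 (Int.gcd_eq_zero_iff.mp h0).1
    -- the values at `y` and at `lam` agree modulo the greatest common divisor at `x`
    have hmod : ∀ p : LinPoly t, (gcdAt f g x i : ℤ) ∣ p.eval (fun s => (lam s : ℤ)) →
        (gcdAt f g x i : ℤ) ∣ p.eval y := by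
      intro p hp
      have hsub : p.eval (fun s => (lam s : ℤ)) - p.eval y =
          ∑ s, p.coeff s * (lam s - y s) := by
        simp only [LinPoly.eval, mul_sub, Finset.sum_sub_distrib]; ring
      have hN : (gcdAt f g x i : ℤ) ∣ modulus f g x L := by
        exact_mod_cast gcdAt_dvd_modulus hi hv0
      have hdvd : (gcdAt f g x i : ℤ) ∣ p.eval (fun s => (lam s : ℤ)) - p.eval y := by
        rw [hsub]
        refine Finset.dvd_sum fun s _ => Dvd.dvd.mul_left ?_ _
        have : (lam s : ℤ) - y s = (lam s - r s) - modulus f g x L * z (yVar k s) := by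
          rw [hy]; simp only [Pi.add_apply, Pi.smul_apply, smul_eq_mul]; ring
        rw [this]
        exact dvd_sub (hN.trans (hrm s)) (hN.mul_right _)
      exact (dvd_sub_right hp).mp hdvd
    rw [← h.gcd_eval]
    refine Nat.dvd_antisymm ?_ ?_
    · have h3 : (Int.gcd (((gapFamily f g c x u E L).F i).eval y)
          (((gapFamily f g c x u E L).G i).eval y) : ℤ) ∣ gcdAt f g x i := by
        rw [← dvd_add_right ((Int.gcd_dvd_left _ _).trans h1)]
        exact (Int.gcd_dvd_right _ _).trans h2
      exact_mod_cast h3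
    · have h3 := Int.dvd_coe_gcd
        (hmod ((gapFamily f g c x u E L).F i) (by
          rw [← h.gcd_eval_self i]; exact Int.gcd_dvd_left _ _))
        (hmod ((gapFamily f g c x u E L).G i) (by
          rw [← h.gcd_eval_self i]; exact Int.gcd_dvd_right _ _))
      exact_mod_cast h3
  · -- one of the polynomials vanishes, and the other is constant
    rw [← h.gcd_eval, ← h.gcd_eval_self]
    have hself := h.gcd_eval_self i
    by_cases hf : (f i).eval x = 0
    · rw [h.F_eq_zero hf] at hself ⊢
      have h0 : ∀ w : Fin t → ℤ, (0 : LinPoly t).eval w = 0 := fun w => by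
        simp [LinPoly.eval, LinPoly.coeff, LinPoly.const]
      simp only [h0, Int.gcd_zero_left] at hself ⊢
      have hc : ((gapFamily f g c x u E L).G i).IsConstant :=
        h.isConstant_of_eval_le (h.G_nonneg i).1 (by
          change ((gapFamily f g c x u E L).G i).eval _ ≤ _
          omega)
      rw [hc.eval_eq, hc.eval_eq]
    · have hg : (g i).eval x = 0 := by
        by_contra hg
        exact hfg ⟨hf, hg⟩
      rw [h.G_eq_zero hg] at hself ⊢
      have h0 : ∀ w : Fin t → ℤ, (0 : LinPoly t).eval w = 0 := fun w => by
        simp [LinPoly.eval, LinPoly.coeff, LinPoly.const]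
      simp only [h0, Int.gcd_zero_right] at hself ⊢
      have hc : ((gapFamily f g c x u E L).F i).IsConstant :=
        h.isConstant_of_eval_le (h.F_nonneg i).1 (by
          change ((gapFamily f g c x u E L).F i).eval _ ≤ _
          omega)
      rw [hc.eval_eq, hc.eval_eq]

theorem kind_z_iff {i : Fin k} :
    (gapFamily f g c x u E L).kind i = .z ↔ L < gcdAt f g x i := by
  simp only [gapFamily]
  split_ifs with h1 h2 <;> simp [h1]

theorem of_kind_w {i : Fin k} (hi : (gapFamily f g c x u E L).kind i = .w) :
    ¬ L < gcdAt f g x i ∧ (f i).eval x ≠ 0 ∧ (g i).eval x ≠ 0 := by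
  simp only [gapFamily] at hi
  split_ifs at hi with h1 h2
  exact ⟨h1, h2⟩

theorem c_pos {i : Fin k} (hi : (gapFamily f g c x u E L).kind i ≠ .y) :
    0 < (gapFamily f g c x u E L).c i := by
  by_cases h1 : L < gcdAt f g x i
  · simp only [gapFamily, h1, if_true]; positivity
  · by_cases h2 : (f i).eval x ≠ 0 ∧ (g i).eval x ≠ 0
    · simp only [gapFamily, h1, if_false]
      exact_mod_cast Int.gcd_pos_of_ne_zero_left _ h2.1
    · exact absurd (by simp only [gapFamily, h1, if_false]; exact if_neg h2) hi

/-- The point itself comes from a solution of the encoding. -/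
theorem exists_isSolution (h : IsGapPoint f g c x u E lam B L) {r q : Fin t → ℕ}
    (hrq : ∀ s, lam s = r s + modulus f g x L * q s) :
    ∃ z : Fin (t + (k + k)) → ℕ, (∀ s, z (yVar k s) = q s) ∧
      ((gapFamily f g c x u E L).dilate (modulus f g x L) fun s => r s).system.IsSolution
        (fun i => (z i : ℤ)) := by
  have hlam : (fun s => (r s : ℤ)) + (modulus f g x L : ℤ) • (fun s => (q s : ℤ)) =
      fun s => (lam s : ℤ) := by
    funext s
    simp [hrq s]
  refine GcdFamily.exists_isSolution q (fun i hi => ?_) (fun i hi => ?_) <;>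
    change (gapFamily f g c x u E L).kind i = _ at hi
  · have hL := kind_z_iff.mp hi
    simp only [GcdFamily.dilate, LinPoly.eval_dilate, hlam, h.gcd_eval_self]
    have := h.c_lt i
    simp only [gapFamily, hL, if_true]
    omega
  · obtain ⟨hL, hf, hg⟩ := of_kind_w hi
    simp only [GcdFamily.dilate, LinPoly.eval_dilate, hlam, h.gcd_eval_self]
    refine ⟨⟨?_, ?_⟩, by simp [gapFamily, hL]⟩
    · exact ((h.F_nonneg i).2 hf).trans_le
        ((h.F_nonneg i).1.const_le_eval fun s => Int.natCast_nonneg _)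
    · exact ((h.G_nonneg i).2 hg).trans_le
        ((h.G_nonneg i).1.const_le_eval fun s => Int.natCast_nonneg _)

theorem isGcdToDiv_triple (h : IsGapPoint f g c x u E lam B L) {N : ℤ} (hN : 0 ≤ N)
    {r : Fin t → ℤ} (hr : ∀ s, 0 ≤ r s) (u' : Fin d → ℤ) (E' : Matrix (Fin d) (Fin t) ℤ) :
    (((gapFamily f g c x u E L).dilate N r).triple u' E').IsGcdToDiv := by
  have hF := fun i => (h.F_nonneg i).1.const_le_eval hr
  have hG := fun i => (h.G_nonneg i).1.const_le_eval hr
  refine GcdFamily.isGcdToDiv u' E' (fun i hi => c_pos (f := f) (g := g) (c := c) (x := x) (u := u) (E := E) hi) (fun i => ⟨fun s => ?_, ?_⟩)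
    (fun i => ⟨fun s => ?_, ?_⟩) (fun i hi => ?_)
  · exact mul_nonneg hN ((h.F_nonneg i).1.1 s)
  · exact (h.F_nonneg i).1.2.trans (hF i)
  · exact mul_nonneg hN ((h.G_nonneg i).1.1 s)
  · exact (h.G_nonneg i).1.2.trans (hG i)
  · change (gapFamily f g c x u E L).kind i = _ at hi
    obtain ⟨-, hf, hg⟩ := of_kind_w hi
    exact ⟨((h.F_nonneg i).2 hf).trans_le (hF i), ((h.G_nonneg i).2 hg).trans_le (hG i)⟩

theorem independent (h : IsGapPoint f g c x u E lam B L) {A S : ℤ} (hA : 1 ≤ A)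
    (hL : A * S ≤ L) (hL' : A ^ 2 * B ≤ L)
    (hF : ∀ i, (∀ s, ((gapFamily f g c x u E L).F i).coeff s ≤ A) ∧
      ((gapFamily f g c x u E L).F i).const ≤ S)
    (hG : ∀ i, (∀ s, ((gapFamily f g c x u E L).G i).coeff s ≤ A) ∧
      ((gapFamily f g c x u E L).G i).const ≤ S) :
    (gapFamily f g c x u E L).Independent := by
  refine GcdFamily.independent_of_gap (y := fun s => (lam s : ℤ)) (B := B) hA hL hL'
    (fun i => ⟨(h.F_nonneg i).1, (hF i).1, (hF i).2⟩)
    (fun i => ⟨(h.G_nonneg i).1, (hG i).1, (hG i).2⟩) (fun s => Int.natCast_nonneg _)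
    (fun i s hs => by exact_mod_cast h.lt_of_coeff_ne_zero hs) (fun i hi => ?_) (fun i hi => ?_)
  · rw [h.gcd_eval_self]
    exact_mod_cast kind_z_iff.mp hi
  · obtain ⟨hn, hf, hg⟩ := of_kind_w hi
    rw [h.gcd_eval_self]
    exact ⟨⟨(h.F_nonneg i).2 hf, (h.G_nonneg i).2 hg⟩,
      by exact_mod_cast (h.gap i).resolve_right hn⟩

end IsGapPoint

end Point

/-! ### Bit lengths of the data of a system -/

theorem natAbs_add_two_le {a : ℤ} {s : ℕ} (h : intSize a ≤ s) : a.natAbs + 2 ≤ 2 ^ s := by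
  have h1 : a.natAbs + 1 ≤ 2 ^ Nat.clog 2 (a.natAbs + 1) := Nat.le_pow_clog (by norm_num) _
  have h2 : 2 ^ (1 + Nat.clog 2 (a.natAbs + 1)) ≤ 2 ^ s := Nat.pow_le_pow_right (by norm_num) h
  rw [pow_add] at h2
  omega

theorem le_vecSize {n : ℕ} (s : Fin n → ℕ) (i : Fin n) : s i ≤ vecSize s :=
  (Finset.single_le_sum (fun _ _ => Nat.zero_le _) (Finset.mem_univ i)).trans
    (Nat.le_add_left _ _)

theorem le_listSize {α : Type} (s : α → ℕ) {l : List α} {a : α} (h : a ∈ l) :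
    s a ≤ listSize s l :=
  (List.le_sum_of_mem (List.mem_map_of_mem h)).trans (Nat.le_add_left _ _)

namespace System

variable {d : ℕ} (Φ : System d)

theorem dims_le_size : d + Φ.rows + Φ.gcds.length ≤ Φ.size := by
  rw [size, matrixSize, vecSize, vecSize, listSize]
  omega

theorem natAbs_A_le (r : Fin Φ.rows) (j : Fin d) : (Φ.A r j).natAbs + 2 ≤ 2 ^ Φ.size := by
  refine natAbs_add_two_le ?_
  have h1 := le_vecSize (fun i => intSize (Φ.A i j)) r
  have h2 := le_vecSize (fun j => vecSize fun i => intSize (Φ.A i j)) j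
  rw [size, matrixSize]
  omega

theorem natAbs_b_le (r : Fin Φ.rows) : (Φ.b r).natAbs + 2 ≤ 2 ^ Φ.size := by
  refine natAbs_add_two_le ?_
  have h1 := le_vecSize (fun i => intSize (Φ.b i)) r
  rw [size]
  omega

variable {Φ}

theorem natAbs_gcd_le {γ : GCDConstraint d} (hγ : γ ∈ Φ.gcds) :
    ((∀ j, (γ.f.coeff j).natAbs + 2 ≤ 2 ^ Φ.size) ∧ γ.f.const.natAbs + 2 ≤ 2 ^ Φ.size) ∧
    ((∀ j, (γ.g.coeff j).natAbs + 2 ≤ 2 ^ Φ.size) ∧ γ.g.const.natAbs + 2 ≤ 2 ^ Φ.size) ∧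
    γ.c + 2 ≤ 2 ^ Φ.size := by
  have h0 : γ.size ≤ Φ.size := (le_listSize GCDConstraint.size hγ).trans (Nat.le_add_left _ _)
  rw [GCDConstraint.size, LinPoly.size, LinPoly.size] at h0
  refine ⟨⟨fun j => natAbs_add_two_le ?_, natAbs_add_two_le ?_⟩,
    ⟨fun j => natAbs_add_two_le ?_, natAbs_add_two_le ?_⟩,
    natAbs_add_two_le (a := (γ.c : ℤ)) ?_⟩
  · have := le_vecSize (fun i => intSize (γ.f.coeff i)) j
    omega
  · omega
  · have := le_vecSize (fun i => intSize (γ.g.coeff i)) j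
    omega
  · omega
  · omega

end System

/-! ### The polynomial bound -/

/-- The logarithm of the bound on coefficients, for systems of bit length `s`. -/
def expA {R : Type} [CommSemiring R] (s : R) : R :=
  2 + s + s + (4 * s + 1) + (5 * s + 1) * (4 * s + 1)

/-- The logarithm of the bound on small values, for systems of bit length `s`. -/
def expB {R : Type} [CommSemiring R] (s : R) : R := 2 * expA s * (5 * s + 1)

/-- The logarithm of the bound on all numbers in the triples, for systems of bit length `s`. -/
def expQ {R : Type} [CommSemiring R] (s : R) : R :=
  2 + (4 * s + 1) + expA s + expB s + expB s * s

/-- The bound on the bit length of the triples, for systems of bit length `s`. -/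
def sizeBound {R : Type} [CommSemiring R] (s : R) : R :=
  s * 2 * (2 * ((4 * s + 1 + (s + s) + 1) * (expQ s + 2)) + 1) + s * (expQ s + 2) +
    (4 * s + 1 + (s + s)) * (s * (expQ s + 2) + 1)

theorem eval_sizeBound (s : ℕ) :
    (sizeBound (Polynomial.X : Polynomial ℕ)).eval s = sizeBound s := by
  simp [sizeBound, expQ, expB, expA]

/-! ### Triples for the solutions of a system -/

section Main

variable {d : ℕ}

/-- The linear polynomial `bᵣ - Aᵣ x` of the `r`-th inequality. -/
def System.row (Φ : System d) (r : Fin Φ.rows) : LinPoly d := (fun j => -Φ.A r j, Φ.b r)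

theorem System.eval_row_nonneg_iff (Φ : System d) (r : Fin Φ.rows) (x : Fin d → ℤ) :
    0 ≤ (Φ.row r).eval x ↔ Φ.A.mulVec x r ≤ Φ.b r := by
  simp only [row, LinPoly.eval, LinPoly.coeff, LinPoly.const, Matrix.mulVec, dotProduct,
    neg_mul, Finset.sum_neg_distrib]
  constructor <;> intro h <;> linarith

/-- Every solution is a gap point, with data bounded in terms of the bit length of the system. -/
theorem System.exists_isGapPoint (Φ : System d) {k : ℕ} (hk : k = Φ.gcds.length)
    (f g : Fin k → LinPoly d) (c : Fin k → ℕ) (x : Fin d → ℤ)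
    (hx : ∀ r, 0 ≤ (Φ.row r).eval x)
    (hf : ∀ i, (∀ j, ((f i).coeff j).natAbs + 2 ≤ 2 ^ Φ.size) ∧
      (f i).const.natAbs + 2 ≤ 2 ^ Φ.size)
    (hg : ∀ i, (∀ j, ((g i).coeff j).natAbs + 2 ≤ 2 ^ Φ.size) ∧
      (g i).const.natAbs + 2 ≤ 2 ^ Φ.size)
    (hc : ∀ i, c i + 2 ≤ 2 ^ Φ.size) (A : ℕ) (hA : A = 2 ^ expA Φ.size) :
    ∃ t ≤ 4 * Φ.size + 1, ∃ (u : Fin d → ℤ) (E : Matrix (Fin d) (Fin t) ℤ) (lam : Fin t → ℕ)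
      (B L : ℕ), IsGapPoint f g c x u E lam B L ∧ 1 ≤ B ∧ B ≤ 2 ^ expB Φ.size ∧ L = A ^ 2 * B ∧
      (∀ r, 0 ≤ (Φ.row r).eval u) ∧ (∀ r s, 0 ≤ ∑ j, (Φ.row r).coeff j * E j s) ∧
      (∀ l, (u l).natAbs ≤ A * B) ∧ (∀ l s, (E l s).natAbs ≤ A) ∧
      ∀ p : LinPoly d, ((∀ j, (p.coeff j).natAbs + 2 ≤ 2 ^ Φ.size) ∧
        p.const.natAbs + 2 ≤ 2 ^ Φ.size) →
        (∀ s, ((p.comp u E).coeff s).natAbs ≤ A) ∧ (p.comp u E).const.natAbs ≤ A * B := by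
  set s := Φ.size with hs
  have hdims := Φ.dims_le_size
  rw [← hs, ← hk] at hdims
  let p : Fin Φ.rows ⊕ ((Fin k × Bool) ⊕ (Fin k × Bool)) → LinPoly d :=
    Sum.elim Φ.row (Sum.elim (fun i => (f i.1).signRow ((f i.1).eval x) i.2)
      (fun i => (g i.1).signRow ((g i.1).eval x) i.2))
  set n := 2 * d + (Φ.rows + (k * 2 + k * 2)) + 1 with hn
  have hH1 : 1 ≤ 2 ^ s := Nat.one_le_two_pow
  have hA2 : 2 ≤ A ^ 2 := by
    rw [hA, ← pow_mul]
    exact Nat.le_self_pow (by simp [expA]) 2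
  obtain ⟨t, ht, j, hj, u, E, lam, hxu, hu, hE, hlarge, hgap, hub, hEb⟩ :=
    exists_gap_decomposition p (2 ^ s) hH1
      (by
        rintro (r | ⟨i, b⟩ | ⟨i, b⟩) j
        · have := Φ.natAbs_A_le r j
          rw [← hs] at this
          simp only [p, Sum.elim_inl, System.row, LinPoly.coeff, Int.natAbs_neg]
          omega
        · simp only [p, Sum.elim_inl, Sum.elim_inr, LinPoly.natAbs_coeff_signRow]
          have := (hf i).1 j
          omega
        · simp only [p, Sum.elim_inr, LinPoly.natAbs_coeff_signRow]
          have := (hg i).1 j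
          omega)
      (by
        rintro (r | ⟨i, b⟩ | ⟨i, b⟩)
        · have := Φ.natAbs_b_le r
          rw [← hs] at this
          simp only [p, Sum.elim_inl, System.row, LinPoly.const]
          omega
        · refine (LinPoly.natAbs_const_signRow_le _ _ _).trans ?_
          have := (hf i).2
          dsimp only
          omega
        · refine (LinPoly.natAbs_const_signRow_le _ _ _).trans ?_
          have := (hg i).2
          dsimp only
          omega)
      x
      (by
        rintro (r | ⟨i, b⟩ | ⟨i, b⟩)
        · exact hx r
        · exact LinPoly.eval_signRow_self_nonneg _ _ _
        · exact LinPoly.eval_signRow_self_nonneg _ _ _)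
      (gcdAt f g x) hA2 n ((n * 2 ^ s) ^ n) (by simp [hn]) rfl
  rw [Fintype.card_fin] at hj
  have hns : n ≤ 4 * s + 1 := by omega
  have hds : d ≤ 2 ^ s := (show d ≤ s by omega).trans Nat.lt_two_pow_self.le
  have hnY : n ≤ 2 ^ (4 * s + 1) := hns.trans Nat.lt_two_pow_self.le
  have hD : (n * 2 ^ s) ^ n ≤ 2 ^ ((5 * s + 1) * (4 * s + 1)) := by
    rw [pow_mul]
    refine (Nat.pow_le_pow_left (?_ : _ ≤ 2 ^ (5 * s + 1)) n).trans
      (Nat.pow_le_pow_right (by positivity) hns)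
    calc n * 2 ^ s ≤ 2 ^ (4 * s + 1) * 2 ^ s := Nat.mul_le_mul_right _ hnY
      _ = 2 ^ (5 * s + 1) := by
        rw [← pow_add]
        exact congrArg (2 ^ ·) (by ring)
  set D := (n * 2 ^ s) ^ n with hDdef
  set B := (A ^ 2) ^ j with hB
  have hB1 : 1 ≤ B := Nat.one_le_pow _ _ (by omega)
  set X := 2 ^ s with hX
  set Y := 2 ^ (4 * s + 1) with hY
  set Z := 2 ^ ((5 * s + 1) * (4 * s + 1)) with hZ
  have hAX : A = 4 * X * X * Y * Z := by
    rw [hA, expA, hX, hY, hZ]; ring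
  have hY1 : 1 ≤ Y := Nat.one_le_two_pow
  have hZ1 : 1 ≤ Z := Nat.one_le_two_pow
  have hYZ : 1 ≤ Y * Z := Nat.mul_pos hY1 hZ1
  have hXA : X ≤ A := by
    rw [hAX]
    calc X = 1 * 1 * X * 1 * 1 := by ring
      _ ≤ 4 * X * X * Y * Z := by gcongr; norm_num
  have hnD : n * D + n * (D * B) ≤ 2 * (Y * Z * B) := by
    calc n * D + n * (D * B) ≤ Y * Z * B + Y * (Z * B) := by
          refine Nat.add_le_add ?_ (by gcongr)
          calc n * D = n * D * 1 := by ring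
            _ ≤ Y * Z * B := by gcongr
      _ = 2 * (Y * Z * B) := by ring
  have hu' : ∀ l, (u l).natAbs ≤ 2 * (Y * Z * B) := fun l => (hub l).trans hnD
  refine ⟨t, ht.trans hns, u, E, lam, B, A ^ 2 * B, ?_, hB1, ?_, rfl, fun r => hu (.inl r),
    fun r => hE (.inl r), fun l => (hu' l).trans ?_, fun l s => (hEb l s).trans (hD.trans ?_),
    fun q hq => ⟨fun s => ?_, ?_⟩⟩
  · have hL : (A ^ 2) ^ (j + 1) = A ^ 2 * B := by rw [pow_succ, mul_comm]
    refine ⟨hxu, fun i b => hu (.inr (.inl (i, b))), fun i b => hE (.inr (.inl (i, b))),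
      fun i b => hu (.inr (.inr (i, b))), fun i b => hE (.inr (.inr (i, b))), ?_, ?_, fun i => ?_⟩
    · rwa [hL] at hlarge
    · rwa [hL] at hgap
    · have h1 := hc i
      have h2 : A ≤ A ^ 2 * B := by
        calc A = A ^ 1 * 1 := by ring
          _ ≤ A ^ 2 * B := by
            gcongr
            · exact hH1.trans hXA
            · norm_num
      omega
  · rw [hB, hA, ← pow_mul, ← pow_mul, expB]
    refine Nat.pow_le_pow_right (by norm_num) ?_
    have : j ≤ 5 * s + 1 := by omega
    calc expA s * (2 * j) ≤ expA s * (2 * (5 * s + 1)) := by gcongr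
      _ = 2 * expA s * (5 * s + 1) := by ring
  · calc 2 * (Y * Z * B) = 2 * 1 * 1 * Y * Z * B := by ring
      _ ≤ 4 * X * X * Y * Z * B := by gcongr; norm_num
      _ = A * B := by rw [hAX]
  · calc Z = 1 * 1 * 1 * 1 * Z := by ring
      _ ≤ 4 * X * X * Y * Z := by gcongr; norm_num
      _ = A := hAX.symm
  · rw [LinPoly.coeff_comp]
    refine (Int.natAbs_sum_le _ _).trans ((Finset.sum_le_card_nsmul _ _ (X * Z)
      fun l _ => ?_).trans ?_)
    · rw [Int.natAbs_mul]
      have := hq.1 l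
      exact Nat.mul_le_mul (by omega) ((hEb l s).trans hD)
    · rw [Finset.card_univ, Fintype.card_fin, smul_eq_mul]
      calc d * (X * Z) ≤ X * (X * Z) := Nat.mul_le_mul_right _ hds
        _ = 1 * X * X * 1 * Z := by ring
        _ ≤ 4 * X * X * Y * Z := by gcongr; norm_num
        _ = A := hAX.symm
  · rw [LinPoly.const_comp]
    refine (LinPoly.natAbs_eval_le q X (2 * (Y * Z * B)) (fun l => ?_) ?_ u hu').trans ?_
    · have := hq.1 l; omega
    · have := hq.2; omega
    · calc d * (X * (2 * (Y * Z * B))) + X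
          ≤ X * (X * (2 * (Y * Z * B))) + X * (X * (2 * (Y * Z * B))) := by
            refine Nat.add_le_add (Nat.mul_le_mul_right _ hds) ?_
            refine Nat.le_mul_of_pos_right _ ?_
            have : 0 < Y * Z * B := Nat.mul_pos hYZ hB1
            positivity
        _ = A * B := by rw [hAX]; ring

/-- Every solution lies in the set of a small 3-increasing GCD-to-DIV triple that contains only
solutions. -/
theorem System.exists_triple (Φ : System d) (x : Fin d → ℤ) (hx : Φ.IsSolution x) :
    ∃ T : Triple d, (T.IsGcdToDiv ∧ T.size ≤ sizeBound Φ.size ∧ T.Ψ.IsRIncreasing 3) ∧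
      (∃ lam : Fin T.m → ℕ, T.Ψ.IsSolution (fun i => (lam i : ℤ)) ∧
        x = T.u + T.E.mulVec (fun i => (lam i : ℤ))) ∧
      ∀ lam : Fin T.m → ℕ, T.Ψ.IsSolution (fun i => (lam i : ℤ)) →
        Φ.IsSolution (T.u + T.E.mulVec (fun i => (lam i : ℤ))) := by
  obtain ⟨k, hk⟩ : ∃ k, k = Φ.gcds.length := ⟨_, rfl⟩
  let γ : Fin k → GCDConstraint d := fun i => Φ.gcds.get (i.cast hk)
  have hγ : ∀ i, γ i ∈ Φ.gcds := fun i => List.get_mem _ _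
  let f : Fin k → LinPoly d := fun i => (γ i).f
  let g : Fin k → LinPoly d := fun i => (γ i).g
  let c : Fin k → ℕ := fun i => (γ i).c
  have hbd := fun i => System.natAbs_gcd_le (hγ i)
  obtain ⟨A, hA⟩ : ∃ A, A = 2 ^ expA Φ.size := ⟨_, rfl⟩
  obtain ⟨t, ht, u, E, lam, B, L, h, hB1, hB, hL, hrow, hrowE, hu, hE, hcomp⟩ :=
    Φ.exists_isGapPoint hk f g c x (fun r => (Φ.eval_row_nonneg_iff r x).mpr (hx.1 r))
      (fun i => (hbd i).1) (fun i => (hbd i).2.1) (fun i => (hbd i).2.2) A hA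
  have hA1 : 1 ≤ A := hA ▸ Nat.one_le_two_pow
  obtain ⟨N, hN⟩ : ∃ N, N = modulus f g x L := ⟨_, rfl⟩
  have hN0 : 0 < N := hN ▸ modulus_pos f g x L
  -- the variables are restricted to the residue class of `lam` modulo `N`
  let r : Fin t → ℕ := fun s => lam s % N
  let q : Fin t → ℕ := fun s => lam s / N
  have hrq : ∀ s, lam s = r s + N * q s := fun s => (Nat.mod_add_div _ _).symm
  let D := (gapFamily f g c x u E L).dilate N (fun s => (r s : ℤ))
  let u' : Fin d → ℤ := u + E.mulVec fun s => (r s : ℤ)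
  let E' : Matrix (Fin d) (Fin t) ℤ := (N : ℤ) • E
  have hsubst : ∀ z : Fin t → ℤ, u' + E'.mulVec z =
      u + E.mulVec ((fun s => (r s : ℤ)) + (N : ℤ) • z) := fun z => by
    simp only [u', E', Matrix.mulVec_add, Matrix.mulVec_smul, Matrix.smul_mulVec, add_assoc]
  have hT : ∀ z : Fin (t + (k + k)) → ℤ,
      (D.triple u' E').u + (D.triple u' E').E.mulVec z =
        u + E.mulVec ((fun s => (r s : ℤ)) + (N : ℤ) • fun s => z (yVar k s)) := fun z =>
    (congrArg (u' + ·) (GcdFamily.mulVec_triple u' E' z)).trans (hsubst _)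
  have hsign : ∀ (v : ℤ) {a : ℤ} {M : ℕ}, a.natAbs ≤ M → (v.sign * a).natAbs ≤ M := by
    intro v a M ha
    rw [Int.natAbs_mul]
    have hv : v.sign.natAbs ≤ 1 := by
      rcases lt_trichotomy v 0 with h | h | h
      · simp [Int.sign_eq_neg_one_of_neg h]
      · simp [h]
      · simp [Int.sign_eq_one_of_pos h]
    exact (Nat.mul_le_mul hv ha).trans (one_mul M).le
  have hFb : ∀ i, (∀ s, (((gapFamily f g c x u E L).F i).coeff s).natAbs ≤ A) ∧
      ((gapFamily f g c x u E L).F i).const.natAbs ≤ A * B := fun i =>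
    ⟨fun s => hsign _ ((hcomp _ (hbd i).1).1 s), hsign _ (hcomp _ (hbd i).1).2⟩
  have hGb : ∀ i, (∀ s, (((gapFamily f g c x u E L).G i).coeff s).natAbs ≤ A) ∧
      ((gapFamily f g c x u E L).G i).const.natAbs ≤ A * B := fun i =>
    ⟨fun s => hsign _ ((hcomp _ (hbd i).2.1).1 s), hsign _ (hcomp _ (hbd i).2.1).2⟩
  refine ⟨D.triple u' E', ⟨?_, ?_, ?_⟩, ?_, ?_⟩
  · exact h.isGcdToDiv_triple (Int.natCast_nonneg _) (fun s => Int.natCast_nonneg _) u' E'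
  · -- every number is less than `2 ^ expQ = 4 W`
    have hdims := Φ.dims_le_size
    rw [← hk] at hdims
    set s := Φ.size
    obtain ⟨M, hM⟩ : ∃ M, M = 2 ^ (expB s * s) := ⟨_, rfl⟩
    have hM1 : 1 ≤ M := hM ▸ Nat.one_le_two_pow
    have hNM : N ≤ M := by
      rw [hN, hM, pow_mul]
      exact (h.modulus_le hB1).trans ((Nat.pow_le_pow_left hB k).trans
        (Nat.pow_le_pow_right (by positivity) (by omega)))
    obtain ⟨Y, hY⟩ : ∃ Y, Y = 2 ^ (4 * s + 1) := ⟨_, rfl⟩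
    have hY1 : 1 ≤ Y := hY ▸ Nat.one_le_two_pow
    have htY : t ≤ Y := hY ▸ ht.trans Nat.lt_two_pow_self.le
    obtain ⟨B', hB'⟩ : ∃ B', B' = 2 ^ expB s := ⟨_, rfl⟩
    rw [← hB'] at hB
    obtain ⟨W, hW⟩ : ∃ W, W = Y * A * B' * M := ⟨_, rfl⟩
    have hQ : 2 ^ expQ s = 4 * W := by
      rw [expQ, pow_add, pow_add, pow_add, pow_add, hW, hY, hA, hB', hM]
      ring
    have hB'1 : 1 ≤ B' := hB1.trans hB
    have hW1 : 1 ≤ W := by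
      rw [hW]
      calc 1 = 1 * 1 * 1 * 1 := by norm_num
        _ ≤ Y * A * B' * M := by gcongr
    have hABW : A * B ≤ W := by
      rw [hW]
      calc A * B = 1 * A * B * 1 := by ring
        _ ≤ Y * A * B' * M := by gcongr
    have hNAW : N * A ≤ W := by
      rw [hW]
      calc N * A = 1 * A * 1 * N := by ring
        _ ≤ Y * A * B' * M := by gcongr
    have htW : t * (A * B * N) ≤ W := by
      rw [hW]
      calc t * (A * B * N) = t * A * B * N := by ring
        _ ≤ Y * A * B' * M := by gcongr
    have hAB : A ≤ A * B := Nat.le_mul_of_pos_right _ hB1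
    have hr : ∀ s, ((r s : ℤ)).natAbs ≤ N := fun s => by
      simpa using (Nat.mod_lt _ hN0).le
    have hdil : ∀ p : LinPoly t, ((∀ s, (p.coeff s).natAbs ≤ A) ∧ p.const.natAbs ≤ A * B) →
        (∀ l, ((p.dilate N fun s => (r s : ℤ)).coeff l).natAbs < 2 ^ expQ s) ∧
          (p.dilate N fun s => (r s : ℤ)).const.natAbs < 2 ^ expQ s := by
      refine fun p hp => ⟨fun l => ?_, ?_⟩
      · rw [LinPoly.coeff_dilate, Int.natAbs_mul, Int.natAbs_natCast, hQ]
        have := Nat.mul_le_mul_left N (hp.1 l)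
        omega
      · rw [LinPoly.const_dilate, hQ]
        have := LinPoly.natAbs_eval_le p (A * B) N (fun l => (hp.1 l).trans hAB) hp.2
          (fun s => (r s : ℤ)) hr
        omega
    refine (GcdFamily.size_triple_le u' E' (Q := expQ s) (by simp only [expQ]; omega) (fun i => ?_)
      (fun i => hdil _ (hFb i)) (fun i => hdil _ (hGb i)) (fun j => ?_) (fun j l => ?_)).trans ?_
    · change ((gapFamily f g c x u E L).c i).natAbs < _
      rw [hQ]
      by_cases hi : L < gcdAt f g x i
      · have h1 := (hbd i).2.2
        have h2 : 2 ^ s ≤ A := by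
          rw [hA]
          exact Nat.pow_le_pow_right (by norm_num) (by simp only [expA]; omega)
        simp only [gapFamily, hi, if_true]
        change ((((γ i).c : ℕ) : ℤ) + 1).natAbs < _
        omega
      · have h1 := (h.gap i).resolve_right hi
        have h2 : B ≤ A * B := Nat.le_mul_of_pos_left _ hA1
        simp only [gapFamily, hi, if_false]
        omega
    · rw [hQ]
      have h1 : (E.mulVec (fun s => (r s : ℤ)) j).natAbs ≤ t * (A * B * N) := by
        refine (Int.natAbs_sum_le Finset.univ fun s => E j s * (r s : ℤ)).trans
          ((Finset.sum_le_card_nsmul _ _ (A * B * N) fun s _ => ?_).trans (by simp))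
        rw [Int.natAbs_mul]
        exact Nat.mul_le_mul ((hE j s).trans hAB) (hr s)
      have h2 := Int.natAbs_add_le (u j) (E.mulVec (fun s => (r s : ℤ)) j)
      have h3 := hu j
      change (u j + E.mulVec (fun s => (r s : ℤ)) j).natAbs < _
      omega
    · rw [hQ]
      change ((N : ℤ) * E j l).natAbs < _
      rw [Int.natAbs_mul, Int.natAbs_natCast]
      have := Nat.mul_le_mul_left N (hE j l)
      omega
    · have hks : k ≤ s := by omega
      have hds : d ≤ s := by omega
      rw [sizeBound]
      gcongr
  · refine GcdFamily.isRIncreasing (GcdFamily.Independent.dilate ?_ (by exact_mod_cast hN0.ne') _)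
    have hle : ∀ {a : ℤ} {M : ℕ}, a.natAbs ≤ M → a ≤ M := fun ha => by omega
    refine h.independent (A := A) (S := (A * B : ℕ)) (by exact_mod_cast hA1) ?_ ?_
      (fun i => ⟨fun s => hle ((hFb i).1 s), hle (hFb i).2⟩)
      (fun i => ⟨fun s => hle ((hGb i).1 s), hle (hGb i).2⟩)
    · rw [hL]; push_cast; exact le_of_eq (by ring)
    · rw [hL]; push_cast; exact le_rfl
  · obtain ⟨z, hzq, hz⟩ := h.exists_isSolution (r := r) (q := q) (hN ▸ hrq)
    rw [← hN] at hz
    refine ⟨z, hz, (h.eq.trans ?_).trans (hT fun i => (z i : ℤ)).symm⟩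
    congr 2
    funext s
    simp [hrq s, hzq]
  · intro z hz
    refine Eq.mpr (congrArg Φ.IsSolution (hT fun i => (z i : ℤ))) ?_
    set y : Fin t → ℤ := (fun s => (r s : ℤ)) + (N : ℤ) • fun s => (z (yVar k s) : ℤ) with hy
    have hy0 : ∀ s, 0 ≤ y s := fun s => by
      simp only [hy, Pi.add_apply, Pi.smul_apply, smul_eq_mul]; positivity
    refine ⟨fun i => ?_, fun δ hδ => ?_⟩
    · rw [← Φ.eval_row_nonneg_iff, ← LinPoly.eval_comp]
      exact (hrow i).trans (LinPoly.IsNonneg.const_le_eval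
        (p := (Φ.row i).comp u E) ⟨hrowE i, hrow i⟩ hy0)
    · obtain ⟨l, rfl⟩ := List.mem_iff_get.mp hδ
      obtain ⟨i, rfl⟩ : ∃ i : Fin k, i.cast hk = l := ⟨l.cast hk.symm, rfl⟩
      have hi : (γ i).Holds x := hx.2 _ (hγ i)
      change (γ i).rel.Holds (gcdAt f g x i) (c i) at hi
      change (γ i).rel.Holds (gcdAt f g (u + E.mulVec y) i) (c i)
      have hmod : ∀ s, (N : ℤ) ∣ lam s - (r s : ℤ) := fun s =>
        ⟨q s, by rw [hrq s]; push_cast; ring⟩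
      rcases h.gcdAt_of_isSolution hN (fun s => Int.natCast_nonneg _) hmod
        (z := fun i => (z i : ℤ)) (fun s => Int.natCast_nonneg _) hz i hy with he | ⟨h1, h2⟩
      · rwa [he]
      · -- a relation that holds for a value above `L` holds for all values above `c`
        have h3 := h.c_lt i
        revert hi
        cases (γ i).rel <;> simp only [Rel.Holds] <;> omega

end Main

end IPGCD

theorem mainTheorem5 :
    ∃ P : Polynomial ℕ, ∀ (d : ℕ) (Φ : IPGCD.System d),
      ∃ C : Set (IPGCD.Triple d),
        {x : Fin d → ℤ | Φ.IsSolution x} =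
          {x : Fin d → ℤ | ∃ T ∈ C, ∃ lam : Fin T.m → ℕ,
            T.Ψ.IsSolution (fun i => (lam i : ℤ)) ∧
            x = T.u + T.E.mulVec (fun i => (lam i : ℤ))} ∧
        ∀ T ∈ C,
          T.IsGcdToDiv ∧ T.size ≤ P.eval Φ.size ∧ IPGCD.DivSystem.IsRIncreasing 3 T.Ψ := by
  refine ⟨IPGCD.sizeBound Polynomial.X, fun d Φ => ?_⟩
  refine ⟨{T | (T.IsGcdToDiv ∧ T.size ≤ IPGCD.sizeBound Φ.size ∧ T.Ψ.IsRIncreasing 3) ∧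
    ∀ lam : Fin T.m → ℕ, T.Ψ.IsSolution (fun i => (lam i : ℤ)) →
      Φ.IsSolution (T.u + T.E.mulVec (fun i => (lam i : ℤ)))}, ?_, fun T hT => ?_⟩
  · ext x
    constructor
    · intro hx
      obtain ⟨T, hT, ⟨lam, hlam⟩, hsub⟩ := Φ.exists_triple x hx
      exact ⟨T, ⟨hT, hsub⟩, lam, hlam⟩
    · rintro ⟨T, ⟨-, hsub⟩, lam, hlam, rfl⟩
      exact hsub lam hlam
  · rw [IPGCD.eval_sizeBound]
    exact hT.1
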